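/- **Language.** Fix a set $\mathsf{Prop}$ of propositional variables and an infinite set $\mathsf{Nom}$ of nominals. Formulas are built from variables $p$, nominals $\mathbf i$, $\bot,\top$ by $\neg,\wedge,\vee,\to,\Box,\Diamond$ and the black connectives $\blacklozenge,\blacksquare$ (all treated as primitive symbols); a formula is *basic* if it contains no nominals and no black connectives, and *pure* if it contains no propositional variables. An inequality is an expression $\varphi\le\psi$. **Signed trees.** The signed generation tree $+\varphi$ (resp. $-\varphi$) is the syntax tree of $\varphi$ with root signed $+$ (resp. $-$); a child has the sign of its parent, except that the child of $\neg$ and the first child of $\to$ have the opposite sign. An occurrence is positive (negative) in $\varphi$ if it is signed $+$ ($-$) in $+\varphi$; $\varphi$ is positive (negative) in $p$ if all occurrences of $p$ in $\varphi$ are. Nodes are classified as follows. $\Delta$-adjoint: $\pm\vee,\pm\wedge$. SLR: $+\wedge,+\Diamond,+\neg,-\vee,-\Box,-\neg,-\!\to$. SRA: $+\wedge,+\Box,+\neg,-\vee,-\Diamond,-\neg$. SRR: $+\vee,+\!\to,-\wedge$. Skeleton nodes are the $\Delta$-adjoint and SLR nodes; PIA nodes are the SRA and SRR nodes. **Inductive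 and Sahlqvist inequalities.** Let $\epsilon$ assign to every variable an order-type $1$ or $\partial$, and let $<_\Omega$ be an irreflexive and transitive relation on the variables. A leaf $+p$ with $\epsilon(p)=1$, or $-p$ with $\epsilon(p)=\partial$, is $\epsilon$-critical, and a branch to such a leaf is a critical branch. A signed tree is *$(\Omega,\epsilon)$-inductive* if every critical branch, with leaf variable $p$ say, consists, apart from its leaf, of a (possibly empty) part $P_2$ starting at the root, all of whose nodes are Skeleton nodes, followed by a (possibly empty) part $P_1$ down to the leaf, all of whose nodes are PIA nodes, such that for every SRR node in $P_1$ the subtree $\gamma$ at its child off the branch contains no $\epsilon$-critical leaf and $q<_\Omega p$ for every variable $q$ occurring in $\gamma$. It is *$\epsilon$-Sahlqvist* if every critical branch splits in this way with $P_1$ consisting of SRA nodes only. A basic inequality $\varphi\le\psi$ is $(\Omega,\epsilon)$-inductive (resp. $\epsilon$-Sahlqvist) if both $+\varphi$ and $-\psi$ are. **Algorithm, Stage 1.** Starting from the set $\{\varphi\le\psi\}$, the following rules are applied to members of the set until none is applicable. (1) Distribution, in $+\varphi$ or $-\psi$, at a node all of whose ancestors are Skeleton nodes: $+\Diamond$,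 $+\wedge$, $-\neg$ and $-\!\to$ are distributed over a child $+\vee$, and $-\Box$, $-\vee$, $+\neg$ and $-\!\to$ over a child $-\wedge$. (2) If $p$ occurs in $\alpha\le\beta$, with $\alpha$ negative and $\beta$ positive in $p$, replace $p$ by $\bot$; if $p$ occurs, with $\alpha$ positive and $\beta$ negative in $p$, replace $p$ by $\top$. (3) Splitting: $\alpha\le\beta\wedge\gamma$ becomes $\alpha\le\beta$, $\alpha\le\gamma$; and $\alpha\vee\beta\le\gamma$ becomes $\alpha\le\gamma$, $\beta\le\gamma$. **Algorithm, Stage 2.** For each resulting inequality $\varphi'\le\psi'$ one starts from the system $(\varnothing,\varphi'\le\psi')$ and rewrites systems $(S,\mathsf{Ineq})$, where $S$ is a set of inequalities, by these rules. *Approximation.* Let $\mathsf{Ineq}$ be $\varphi'\le\psi'$, and select an occurrence of a basic subformula $\gamma$ in the tree $+\varphi'$ or $-\psi'$ such that all nodes above $\gamma$ are SLR and the root of $\gamma$ is not an SLR node. For a nominal $\mathbf i$ occurring neither in $S$ nor in $\mathsf{Ineq}$: if $\gamma$ is signed $+$, replace the occurrence by $\mathbf i$ and add $\mathbf i\le\gamma$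 to $S$; if it is signed $-$, replace it by $\neg\mathbf i$ and add $\gamma\le\neg\mathbf i$ to $S$. *Residuation*, rewriting a member of $S$: $\Diamond\gamma\le\delta$ to $\gamma\le\blacksquare\delta$; $\neg\gamma\le\delta$ to $\neg\delta\le\gamma$; $\gamma\le\Box\delta$ to $\blacklozenge\gamma\le\delta$; $\gamma\le\neg\delta$ to $\delta\le\neg\gamma$; $\gamma\wedge\delta\le\beta$ to $\gamma\le\delta\to\beta$ or to $\delta\le\gamma\to\beta$; $\gamma\le\delta\vee\beta$ to $\gamma\wedge\neg\delta\le\beta$ or to $\gamma\wedge\neg\beta\le\delta$; $\gamma\le\delta\to\beta$ to $\gamma\wedge\delta\le\beta$ or to $\delta\le\gamma\to\beta$. *Splitting* of a member of $S$, as in (3). *Right Ackermann rule.* If $S=\{\alpha_i\le p\}_{i=1}^n\cup\{\beta_j\le\gamma_j\}_j$, where $p$ occurs neither in the $\alpha_i$ nor in $\mathsf{Ineq}$, the $\beta_j$ are positive in $p$ and the $\gamma_j$ are negative in $p$, replace $S$ by $\{\beta_j(\bigvee_i\alpha_i/p)\le\gamma_j(\bigvee_i\alpha_i/p)\}_j$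 (the empty disjunction is $\bot$). *Left Ackermann rule.* If $S=\{p\le\alpha_i\}_{i=1}^n\cup\{\beta_j\le\gamma_j\}_j$, where $p$ occurs neither in the $\alpha_i$ nor in $\mathsf{Ineq}$, the $\beta_j$ are negative in $p$ and the $\gamma_j$ are positive in $p$, replace $S$ by $\{\beta_j(\bigwedge_i\alpha_i/p)\le\gamma_j(\bigwedge_i\alpha_i/p)\}_j$ (the empty conjunction is $\top$). **Success.** ALBA *succeeds* on $\varphi\le\psi$ if the rules of Stage 1 can be applied exhaustively, and in whatever order this is done the result is a finite set of inequalities such that the initial system of each of them can be rewritten by the rules of Stage 2 into a system containing no propositional variables. **Theorem.** ALBA succeeds on every basic inequality that is $(\Omega,\epsilon)$-inductive for some order-type $\epsilon$ and some irreflexive and transitive relation $<_\Omega$ on the variables. In particular, ALBA succeeds on every basic inequality that is $\epsilon$-Sahlqvist for some order-type $\epsilon$. -/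

import Mathlib

namespace ALBA

/-- Signs of nodes in signed generation trees.  The order-type `1` of a variable is
represented by `plus` and the order-type `∂` by `minus`, so that a leaf with sign `s` and
variable `p` is `ε`-critical exactly when `s = ε p`. -/
inductive Sign : Type
  | plus : Sign
  | minus : Sign

/-- The opposite sign (also: the opposite order-type). -/
def Sign.flip : Sign → Sign
  | .plus => .minus
  | .minus => .plus

/-- Formulas of the expanded modal language over propositional variables `P` and nominals `N`.
The abbreviations are primitive symbols; `bdia` and `bbox` are the black diamond and the
black box (the adjoints of `box` and `dia`). -/
inductive Form (P : Type*) (N : Type*)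
  | var : P → Form P N
  | nom : N → Form P N
  | bot : Form P N
  | top : Form P N
  | neg : Form P N → Form P N
  | and : Form P N → Form P N → Form P N
  | or : Form P N → Form P N → Form P N
  | imp : Form P N → Form P N → Form P N
  | box : Form P N → Form P N
  | dia : Form P N → Form P N
  | bdia : Form P N → Form P N
  | bbox : Form P N → Form P N

namespace Form

variable {P : Type*} {N : Type*}

/-- The formula belongs to the basic modal language: no nominals, no black connectives. -/
def IsBasic : Form P N → Prop
  | var _ => True
  | nom _ => False
  | bot => True
  | top => True
  | neg a => a.IsBasic
  | and a b => a.IsBasic ∧ b.IsBasic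
  | or a b => a.IsBasic ∧ b.IsBasic
  | imp a b => a.IsBasic ∧ b.IsBasic
  | box a => a.IsBasic
  | dia a => a.IsBasic
  | bdia _ => False
  | bbox _ => False

/-- The propositional variables that occur in a formula. -/
def vars : Form P N → Set P
  | var p => {p}
  | nom _ => ∅
  | bot => ∅
  | top => ∅
  | neg a => a.vars
  | and a b => a.vars ∪ b.vars
  | or a b => a.vars ∪ b.vars
  | imp a b => a.vars ∪ b.vars
  | box a => a.vars
  | dia a => a.vars
  | bdia a => a.vars
  | bbox a => a.vars

/-- The nominals that occur in a formula. -/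
def noms : Form P N → Set N
  | var _ => ∅
  | nom i => {i}
  | bot => ∅
  | top => ∅
  | neg a => a.noms
  | and a b => a.noms ∪ b.noms
  | or a b => a.noms ∪ b.noms
  | imp a b => a.noms ∪ b.noms
  | box a => a.noms
  | dia a => a.noms
  | bdia a => a.noms
  | bbox a => a.noms

/-- The signed variable leaves of the generation tree of a formula whose root has sign `s`. -/
def leaves (s : Sign) : Form P N → Set (Sign × P)
  | var p => {(s, p)}
  | nom _ => ∅
  | bot => ∅
  | top => ∅
  | neg a => a.leaves s.flip
  | and a b => a.leaves s ∪ b.leaves s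
  | or a b => a.leaves s ∪ b.leaves s
  | imp a b => a.leaves s.flip ∪ b.leaves s
  | box a => a.leaves s
  | dia a => a.leaves s
  | bdia a => a.leaves s
  | bbox a => a.leaves s

/-- All occurrences of `p` are positive. -/
def PositiveIn (p : P) (a : Form P N) : Prop := (Sign.minus, p) ∉ a.leaves Sign.plus

/-- All occurrences of `p` are negative. -/
def NegativeIn (p : P) (a : Form P N) : Prop := (Sign.plus, p) ∉ a.leaves Sign.plus

open Classical in
/-- Uniform substitution of the formula `c` for the variable `p`. -/
noncomputable def subst (p : P) (c : Form P N) : Form P N → Form P N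
  | var q => if q = p then c else var q
  | nom i => nom i
  | bot => bot
  | top => top
  | neg a => neg (subst p c a)
  | and a b => and (subst p c a) (subst p c b)
  | or a b => or (subst p c a) (subst p c b)
  | imp a b => imp (subst p c a) (subst p c b)
  | box a => box (subst p c a)
  | dia a => dia (subst p c a)
  | bdia a => bdia (subst p c a)
  | bbox a => bbox (subst p c a)

/-- Finite disjunction; the empty one is `bot`. -/
def bigOr : List (Form P N) → Form P N
  | [] => bot
  | [a] => a
  | a :: b :: l => or a (bigOr (b :: l))

/-- Finite conjunction; the empty one is `top`. -/
def bigAnd : List (Form P N) → Form P N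
  | [] => top
  | [a] => a
  | a :: b :: l => and a (bigAnd (b :: l))

end Form

/-- A frame is an inner node of a generation tree together with the choice of the child through
which a branch passes; for a binary connective it records the other child. For instance
`andL b` is a conjunction whose right conjunct is `b`, on a branch that goes through the
left conjunct. -/
inductive Frame (P : Type*) (N : Type*)
  | neg : Frame P N
  | andL : Form P N → Frame P N
  | andR : Form P N → Frame P N
  | orL : Form P N → Frame P N
  | orR : Form P N → Frame P N
  | impL : Form P N → Frame P N
  | impR : Form P N → Frame P N
  | box : Frame P N
  | dia : Frame P N
  | bdia : Frame P N
  | bbox : Frame P N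

namespace Frame

variable {P : Type*} {N : Type*}

/-- The formula that arises when `a` is the child on the branch. -/
def app : Frame P N → Form P N → Form P N
  | neg, a => .neg a
  | andL b, a => .and a b
  | andR b, a => .and b a
  | orL b, a => .or a b
  | orR b, a => .or b a
  | impL b, a => .imp a b
  | impR b, a => .imp b a
  | box, a => .box a
  | dia, a => .dia a
  | bdia, a => .bdia a
  | bbox, a => .bbox a

/-- The sign of the child on the branch, when the node has sign `s`. -/
def childSign : Frame P N → Sign → Sign
  | neg, s => s.flip
  | impL _, s => s.flip
  | _, s => s

/-- The children off the branch, with their signs, when the node has sign `s`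
(there is at most one). -/
def siblings : Frame P N → Sign → Set (Sign × Form P N)
  | andL b, s => {(s, b)}
  | andR b, s => {(s, b)}
  | orL b, s => {(s, b)}
  | orR b, s => {(s, b)}
  | impL b, s => {(s, b)}
  | impR b, s => {(s.flip, b)}
  | _, _ => ∅

/-- `Δ`-adjoint nodes: `+∨`, `+∧`, `-∧`, `-∨`. -/
def IsDeltaAdjoint : Sign → Frame P N → Prop
  | _, andL _ => True
  | _, andR _ => True
  | _, orL _ => True
  | _, orR _ => True
  | _, _ => False

/-- Syntactically left residual nodes: `+∧`, `+◇`, `+¬`, `-∨`, `-□`, `-¬`, `-→`. -/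
def IsSLR : Sign → Frame P N → Prop
  | .plus, andL _ => True
  | .plus, andR _ => True
  | .plus, dia => True
  | .plus, neg => True
  | .minus, orL _ => True
  | .minus, orR _ => True
  | .minus, box => True
  | .minus, neg => True
  | .minus, impL _ => True
  | .minus, impR _ => True
  | _, _ => False

/-- Syntactically right adjoint nodes: `+∧`, `+□`, `+¬`, `-∨`, `-◇`, `-¬`. -/
def IsSRA : Sign → Frame P N → Prop
  | .plus, andL _ => True
  | .plus, andR _ => True
  | .plus, box => True
  | .plus, neg => True
  | .minus, orL _ => True
  | .minus, orR _ => True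
  | .minus, dia => True
  | .minus, neg => True
  | _, _ => False

/-- Syntactically right residual nodes: `+∨`, `+→`, `-∧`. -/
def IsSRR : Sign → Frame P N → Prop
  | .plus, orL _ => True
  | .plus, orR _ => True
  | .plus, impL _ => True
  | .plus, impR _ => True
  | .minus, andL _ => True
  | .minus, andR _ => True
  | _, _ => False

/-- Skeleton nodes: `Δ`-adjoints and SLR nodes. -/
def IsSkeleton (s : Sign) (f : Frame P N) : Prop := f.IsDeltaAdjoint s ∨ f.IsSLR s

/-- PIA nodes: SRA and SRR nodes. -/
def IsPIA (s : Sign) (f : Frame P N) : Prop := f.IsSRA s ∨ f.IsSRR s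

end Frame

/-- A branch, i.e. a path from the root of a generation tree to some node below it, as the list
of the nodes above that node, the root coming first. It is also a one-hole context. -/
abbrev Branch (P : Type*) (N : Type*) := List (Frame P N)

namespace Branch

variable {P : Type*} {N : Type*}

/-- The formula obtained by putting `a` at the end of the branch. -/
def plug : Branch P N → Form P N → Form P N
  | [], a => a
  | f :: C, a => f.app (plug C a)

/-- The sign at the end of the branch when the root has sign `s`. -/
def endSign : Branch P N → Sign → Sign
  | [], s => s
  | f :: C, s => endSign C (f.childSign s)

/-- The nodes of the branch with their signs, when the root has sign `s`. -/
def nodes : Branch P N → Sign → List (Sign × Frame P N)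
  | [], _ => []
  | f :: C, s => (s, f) :: nodes C (f.childSign s)

/-- All nodes of the branch are SLR nodes. -/
def AllSLR (C : Branch P N) (s : Sign) : Prop := ∀ n ∈ nodes C s, n.2.IsSLR n.1

/-- All nodes of the branch are Skeleton nodes. -/
def AllSkeleton (C : Branch P N) (s : Sign) : Prop := ∀ n ∈ nodes C s, n.2.IsSkeleton n.1

end Branch

namespace Form

variable {P : Type*} {N : Type*}

/-- The signed generation tree `s a` is `(Ω, ε)`-inductive: every critical branch consists of a
Skeleton part `P₂` starting at the root, followed by a PIA part `P₁` ending at the leaf, and each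
SRR node in the PIA part has, off the branch, a subtree that agrees with the order-type opposite
to `ε` and whose variables are all `Ω`-below the variable at the leaf. -/
def IsInductive (Ω : P → P → Prop) (ε : P → Sign) (s : Sign) (a : Form P N) : Prop :=
  ∀ (C : Branch P N) (p : P), C.plug (var p) = a → C.endSign s = ε p →
    ∃ P₂ P₁ : List (Sign × Frame P N), C.nodes s = P₂ ++ P₁ ∧
      (∀ n ∈ P₂, n.2.IsSkeleton n.1) ∧
      (∀ n ∈ P₁, n.2.IsPIA n.1) ∧
      (∀ n ∈ P₁, n.2.IsSRR n.1 → ∀ c ∈ n.2.siblings n.1,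
        (∀ l ∈ c.2.leaves c.1, l.1 = (ε l.2).flip) ∧ ∀ q ∈ c.2.vars, Ω q p)

/-- The signed generation tree `s a` is `ε`-Sahlqvist: every critical branch is excellent. -/
def IsSahlqvist (ε : P → Sign) (s : Sign) (a : Form P N) : Prop :=
  ∀ (C : Branch P N) (p : P), C.plug (var p) = a → C.endSign s = ε p →
    ∃ P₂ P₁ : List (Sign × Frame P N), C.nodes s = P₂ ++ P₁ ∧
      (∀ n ∈ P₂, n.2.IsSkeleton n.1) ∧ (∀ n ∈ P₁, n.2.IsSRA n.1)

end Form

/-- Inequalities `lhs ≤ rhs`. -/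
structure Ineq (P : Type*) (N : Type*) where
  lhs : Form P N
  rhs : Form P N

namespace Ineq

variable {P : Type*} {N : Type*}

def IsBasic (I : Ineq P N) : Prop := I.lhs.IsBasic ∧ I.rhs.IsBasic

def vars (I : Ineq P N) : Set P := I.lhs.vars ∪ I.rhs.vars

def noms (I : Ineq P N) : Set N := I.lhs.noms ∪ I.rhs.noms

/-- No propositional variables occur. -/
def IsPure (I : Ineq P N) : Prop := I.vars = ∅

noncomputable def subst (p : P) (c : Form P N) (I : Ineq P N) : Ineq P N :=
  ⟨Form.subst p c I.lhs, Form.subst p c I.rhs⟩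

def IsInductive (Ω : P → P → Prop) (ε : P → Sign) (I : Ineq P N) : Prop :=
  I.lhs.IsInductive Ω ε .plus ∧ I.rhs.IsInductive Ω ε .minus

def IsSahlqvist (ε : P → Sign) (I : Ineq P N) : Prop :=
  I.lhs.IsSahlqvist ε .plus ∧ I.rhs.IsSahlqvist ε .minus

end Ineq

section Algorithm

variable {P : Type*} {N : Type*}

/-- The local distribution rules at a node of the given sign: `+◇`, `+∧`, `-¬`, `-→` are pushed
down over `+∨`, and `-□`, `-∨`, `+¬`, `-→` over `-∧`. -/
inductive Distributes : Sign → Form P N → Form P N → Prop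
  | dia_or (a b : Form P N) : Distributes .plus (.dia (.or a b)) (.or (.dia a) (.dia b))
  | or_and (a b c : Form P N) :
      Distributes .plus (.and (.or a b) c) (.or (.and a c) (.and b c))
  | and_or (a b c : Form P N) :
      Distributes .plus (.and c (.or a b)) (.or (.and c a) (.and c b))
  | neg_or (a b : Form P N) : Distributes .minus (.neg (.or a b)) (.and (.neg a) (.neg b))
  | or_imp (a b c : Form P N) :
      Distributes .minus (.imp (.or a b) c) (.and (.imp a c) (.imp b c))
  | box_and (a b : Form P N) : Distributes .minus (.box (.and a b)) (.and (.box a) (.box b))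
  | and_or_left (a b c : Form P N) :
      Distributes .minus (.or (.and a b) c) (.and (.or a c) (.or b c))
  | and_or_right (a b c : Form P N) :
      Distributes .minus (.or c (.and a b)) (.and (.or c a) (.or c b))
  | neg_and (a b : Form P N) : Distributes .plus (.neg (.and a b)) (.or (.neg a) (.neg b))
  | imp_and (a b c : Form P N) :
      Distributes .minus (.imp c (.and a b)) (.and (.imp c a) (.imp c b))

/-- The splitting rules: the first inequality is replaced by the other two. -/
inductive Splits : Ineq P N → Ineq P N → Ineq P N → Prop
  | and_right (a b c : Form P N) : Splits ⟨a, .and b c⟩ ⟨a, b⟩ ⟨a, c⟩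
  | or_left (a b c : Form P N) : Splits ⟨.or a b, c⟩ ⟨a, c⟩ ⟨b, c⟩

/-- One application of a rule of Stage 1 to an inequality, with the set of inequalities that
replace it. Distribution takes place in the Skeleton part of the generation trees of `+lhs` and
`-rhs`; a variable is eliminated only if it occurs. -/
inductive Stage1Rule : Ineq P N → Set (Ineq P N) → Prop
  | dist_left (C : Branch P N) (a b r : Form P N) :
      C.AllSkeleton .plus → Distributes (C.endSign .plus) a b →
      Stage1Rule ⟨C.plug a, r⟩ {⟨C.plug b, r⟩}
  | dist_right (C : Branch P N) (a b l : Form P N) :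
      C.AllSkeleton .minus → Distributes (C.endSign .minus) a b →
      Stage1Rule ⟨l, C.plug a⟩ {⟨l, C.plug b⟩}
  | elim_bot (p : P) (I : Ineq P N) :
      p ∈ I.vars → I.lhs.NegativeIn p → I.rhs.PositiveIn p →
      Stage1Rule I {Ineq.subst p .bot I}
  | elim_top (p : P) (I : Ineq P N) :
      p ∈ I.vars → I.lhs.PositiveIn p → I.rhs.NegativeIn p →
      Stage1Rule I {Ineq.subst p .top I}
  | split (I J K : Ineq P N) : Splits I J K → Stage1Rule I {J, K}

/-- One step of Stage 1 on a set of inequalities. -/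
def Stage1Step (X Y : Set (Ineq P N)) : Prop :=
  ∃ I ∈ X, ∃ L, Stage1Rule I L ∧ Y = (X \ {I}) ∪ L

/-- `X` is a result of applying the rules of Stage 1 exhaustively to the inequality `I`. -/
def Stage1Result (I : Ineq P N) (X : Set (Ineq P N)) : Prop :=
  Relation.ReflTransGen Stage1Step {I} X ∧ ∀ J ∈ X, ∀ L, ¬ Stage1Rule J L

/-- A system `(S, Ineq)`. -/
structure ASystem (P : Type*) (N : Type*) where
  S : Set (Ineq P N)
  ineq : Ineq P N

namespace ASystem

/-- No propositional variables occur in the system. -/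
def IsPure (T : ASystem P N) : Prop := (∀ J ∈ T.S, J.IsPure) ∧ T.ineq.IsPure

/-- The nominal `i` does not occur in the system. -/
def Fresh (i : N) (T : ASystem P N) : Prop := (∀ J ∈ T.S, i ∉ J.noms) ∧ i ∉ T.ineq.noms

end ASystem

/-- The residuation rules. -/
inductive Residuates : Ineq P N → Ineq P N → Prop
  | dia (c d : Form P N) : Residuates ⟨.dia c, d⟩ ⟨c, .bbox d⟩
  | neg_left (c d : Form P N) : Residuates ⟨.neg c, d⟩ ⟨.neg d, c⟩
  | box (c d : Form P N) : Residuates ⟨c, .box d⟩ ⟨.bdia c, d⟩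
  | neg_right (c d : Form P N) : Residuates ⟨c, .neg d⟩ ⟨d, .neg c⟩
  | and_one (c d b : Form P N) : Residuates ⟨.and c d, b⟩ ⟨c, .imp d b⟩
  | and_two (c d b : Form P N) : Residuates ⟨.and c d, b⟩ ⟨d, .imp c b⟩
  | or_one (c d b : Form P N) : Residuates ⟨c, .or d b⟩ ⟨.and c (.neg d), b⟩
  | or_two (c d b : Form P N) : Residuates ⟨c, .or d b⟩ ⟨.and c (.neg b), d⟩
  | imp_one (c d b : Form P N) : Residuates ⟨c, .imp d b⟩ ⟨.and c d, b⟩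
  | imp_two (c d b : Form P N) : Residuates ⟨c, .imp d b⟩ ⟨d, .imp c b⟩

/-- The branch `C` from a root of sign `s` is SLR, and it cannot be extended to a longer SLR
branch through the subformula `c` at its end (this makes approximation at `c` pivotal). -/
def MaximalSLR (C : Branch P N) (s : Sign) (c : Form P N) : Prop :=
  C.AllSLR s ∧ ∀ (f : Frame P N) (d : Form P N), c = f.app d → ¬ f.IsSLR (C.endSign s)

/-- One application of a reduction rule of Stage 2: the four approximation rules (applied
pivotally), the residuation and splitting rules (applied to an inequality in `S`), and the two
Ackermann rules. -/
inductive Stage2Step : ASystem P N → ASystem P N → Prop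
  | approx_left_pos (S : Set (Ineq P N)) (C : Branch P N) (c r : Form P N) (i : N) :
      C.endSign .plus = .plus → MaximalSLR C .plus c → c.IsBasic →
      ASystem.Fresh i ⟨S, ⟨C.plug c, r⟩⟩ →
      Stage2Step ⟨S, ⟨C.plug c, r⟩⟩ ⟨S ∪ {⟨.nom i, c⟩}, ⟨C.plug (.nom i), r⟩⟩
  | approx_left_neg (S : Set (Ineq P N)) (C : Branch P N) (c r : Form P N) (i : N) :
      C.endSign .plus = .minus → MaximalSLR C .plus c → c.IsBasic →
      ASystem.Fresh i ⟨S, ⟨C.plug c, r⟩⟩ →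
      Stage2Step ⟨S, ⟨C.plug c, r⟩⟩
        ⟨S ∪ {⟨c, .neg (.nom i)⟩}, ⟨C.plug (.neg (.nom i)), r⟩⟩
  | approx_right_pos (S : Set (Ineq P N)) (C : Branch P N) (c l : Form P N) (i : N) :
      C.endSign .minus = .plus → MaximalSLR C .minus c → c.IsBasic →
      ASystem.Fresh i ⟨S, ⟨l, C.plug c⟩⟩ →
      Stage2Step ⟨S, ⟨l, C.plug c⟩⟩ ⟨S ∪ {⟨.nom i, c⟩}, ⟨l, C.plug (.nom i)⟩⟩
  | approx_right_neg (S : Set (Ineq P N)) (C : Branch P N) (c l : Form P N) (i : N) :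
      C.endSign .minus = .minus → MaximalSLR C .minus c → c.IsBasic →
      ASystem.Fresh i ⟨S, ⟨l, C.plug c⟩⟩ →
      Stage2Step ⟨S, ⟨l, C.plug c⟩⟩
        ⟨S ∪ {⟨c, .neg (.nom i)⟩}, ⟨l, C.plug (.neg (.nom i))⟩⟩
  | residuation (S : Set (Ineq P N)) (E I J : Ineq P N) :
      I ∈ S → Residuates I J → Stage2Step ⟨S, E⟩ ⟨(S \ {I}) ∪ {J}, E⟩
  | splitting (S : Set (Ineq P N)) (E I J K : Ineq P N) :
      I ∈ S → Splits I J K → Stage2Step ⟨S, E⟩ ⟨(S \ {I}) ∪ {J, K}, E⟩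
  | right_ackermann (p : P) (as : List (Form P N)) (S T : Set (Ineq P N)) (E : Ineq P N) :
      S = {J | ∃ a ∈ as, J = ⟨a, .var p⟩} ∪ T →
      (∀ a ∈ as, p ∉ a.vars) → p ∉ E.vars →
      (∀ J ∈ T, J.lhs.PositiveIn p ∧ J.rhs.NegativeIn p) →
      Stage2Step ⟨S, E⟩ ⟨Ineq.subst p (Form.bigOr as) '' T, E⟩
  | left_ackermann (p : P) (as : List (Form P N)) (S T : Set (Ineq P N)) (E : Ineq P N) :
      S = {J | ∃ a ∈ as, J = ⟨.var p, a⟩} ∪ T →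
      (∀ a ∈ as, p ∉ a.vars) → p ∉ E.vars →
      (∀ J ∈ T, J.lhs.NegativeIn p ∧ J.rhs.PositiveIn p) →
      Stage2Step ⟨S, E⟩ ⟨Ineq.subst p (Form.bigAnd as) '' T, E⟩

/-- ALBA succeeds on `I`: the rules of Stage 1 can be applied exhaustively, and, in whatever order
this is done, the result is a finite set of inequalities, and the initial system of each of these
inequalities can be rewritten by the rules of Stage 2 into a system without propositional
variables. -/
def Succeeds (I : Ineq P N) : Prop :=
  (∃ X, Stage1Result I X) ∧
    ∀ X, Stage1Result I X → X.Finite ∧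
      ∀ J ∈ X, ∃ T : ASystem P N,
        Relation.ReflTransGen Stage2Step ⟨∅, J⟩ T ∧ T.IsPure

end Algorithm

end ALBA

/-! After Stage 1 no `+∨` or `-∧` lies in the SLR part of a tree or directly below it, so in an
inductive inequality every maximal SLR branch ends at a subtree whose critical branches consist of
PIA nodes only. Approximating all these subtrees makes `Ineq` pure.

Residuation and splitting bring the critical leaves of the approximated subtrees to the surface,
leaving inequalities `α ≤ p` if `ε p = 1`, and `p ≤ α` if `ε p = ∂`. By the condition on SRR nodes,
`α` creates no new critical leaves when it is substituted for `p`, and its variables are `Ω`-below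
`p`. So `α` does not contain `p`, as `Ω` is irreflexive, and the shape survives the Ackermann rules,
as `Ω` is transitive. Hence the variables can be eliminated one by one, in any order. -/

namespace ALBA

variable {P : Type*} {N : Type*} {Ω : P → P → Prop} {ε : P → Sign}

/-! ### Leaves, frames and branches -/

theorem Sign.eq_flip_iff {s t : Sign} : s = t.flip ↔ s ≠ t := by
  cases s <;> cases t <;> simp [Sign.flip]

namespace Form

theorem app_induction {motive : Form P N → Prop}
    (step : ∀ a, (∀ (f : Frame P N) b, a = f.app b → motive b) → motive a) (a : Form P N) :
    motive a := by
  induction a <;> refine step _ fun f b h => ?_ <;> cases f <;> cases h <;> assumption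

theorem IsBasic.of_app {f : Frame P N} {a : Form P N} (h : (f.app a).IsBasic) : a.IsBasic := by
  cases f <;> first | exact h | exact h.1 | exact h.2 | exact h.elim

theorem eq_var_or_eq_app_of_mem_leaves {a : Form P N} {s t : Sign} {p : P}
    (h : (t, p) ∈ a.leaves s) :
    a = var p ∧ s = t ∨ ∃ (f : Frame P N) (b : Form P N), a = f.app b ∧
      (t, p) ∈ b.leaves (f.childSign s) := by
  cases a with
  | var q =>
    obtain ⟨rfl, rfl⟩ := Prod.mk.inj (Set.mem_singleton_iff.mp h)
    exact .inl ⟨rfl, rfl⟩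
  | nom | bot | top => exact h.elim
  | neg b => exact .inr ⟨.neg, b, rfl, h⟩
  | and b c => exact .inr (h.elim (⟨.andL c, b, rfl, ·⟩) (⟨.andR b, c, rfl, ·⟩))
  | or b c => exact .inr (h.elim (⟨.orL c, b, rfl, ·⟩) (⟨.orR b, c, rfl, ·⟩))
  | imp b c => exact .inr (h.elim (⟨.impL c, b, rfl, ·⟩) (⟨.impR b, c, rfl, ·⟩))
  | box b => exact .inr ⟨.box, b, rfl, h⟩
  | dia b => exact .inr ⟨.dia, b, rfl, h⟩
  | bdia b => exact .inr ⟨.bdia, b, rfl, h⟩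
  | bbox b => exact .inr ⟨.bbox, b, rfl, h⟩

theorem mem_leaves_app {f : Frame P N} {a : Form P N} {s : Sign} {l : Sign × P}
    (h : l ∈ a.leaves (f.childSign s)) : l ∈ (f.app a).leaves s := by
  cases f <;> first | exact h | exact .inl h | exact .inr h

theorem exists_branch_of_mem_leaves {a : Form P N} {s t : Sign} {p : P}
    (h : (t, p) ∈ a.leaves s) : ∃ C : Branch P N, C.plug (var p) = a ∧ C.endSign s = t := by
  induction a using app_induction generalizing s with
  | step a ih =>
    rcases eq_var_or_eq_app_of_mem_leaves h with ⟨rfl, rfl⟩ | ⟨f, b, rfl, hb⟩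
    · exact ⟨[], rfl, rfl⟩
    · obtain ⟨C, rfl, rfl⟩ := ih f b rfl hb
      exact ⟨f :: C, rfl, rfl⟩

theorem mem_vars_iff_exists_mem_leaves {a : Form P N} {p : P} (s : Sign) :
    p ∈ a.vars ↔ ∃ t, (t, p) ∈ a.leaves s := by
  induction a generalizing s with
  | var q => simp [vars, leaves]
  | nom | bot | top => simp [vars, leaves]
  | neg _ ih => exact ih s.flip
  | box _ ih | dia _ ih | bdia _ ih | bbox _ ih => exact ih s
  | and _ _ iha ihb | or _ _ iha ihb => exact (or_congr (iha s) (ihb s)).trans exists_or.symm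
  | imp _ _ iha ihb => exact (or_congr (iha s.flip) (ihb s)).trans exists_or.symm

theorem leaves_eq_empty {a : Form P N} (h : a.vars = ∅) (s : Sign) : a.leaves s = ∅ :=
  Set.eq_empty_of_forall_notMem fun l hl => by
    simpa [h] using (mem_vars_iff_exists_mem_leaves s).mpr ⟨l.1, hl⟩

theorem mem_leaves_flip {a : Form P N} {s t : Sign} {p : P} :
    (t.flip, p) ∈ a.leaves s.flip ↔ (t, p) ∈ a.leaves s := by
  induction a generalizing s with
  | var q => cases s <;> cases t <;> simp [leaves, Sign.flip]
  | nom | bot | top => exact Iff.rfl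
  | neg _ ih => exact ih
  | box _ ih | dia _ ih | bdia _ ih | bbox _ ih => exact ih (s := s)
  | and _ _ iha ihb | or _ _ iha ihb | imp _ _ iha ihb => exact or_congr iha ihb

theorem finite_vars (a : Form P N) : a.vars.Finite := by
  induction a <;> simp_all [vars]

theorem finite_noms (a : Form P N) : a.noms.Finite := by
  induction a <;> simp_all [noms]

/-- No leaf of the signed generation tree `s a` is `ε`-critical. -/
def NonCritical (ε : P → Sign) (s : Sign) (a : Form P N) : Prop :=
  ∀ p, (ε p, p) ∉ a.leaves s

theorem nonCritical_iff {s : Sign} {a : Form P N} :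
    a.NonCritical ε s ↔ ∀ l ∈ a.leaves s, l.1 = (ε l.2).flip := by
  refine ⟨fun h l hl => Sign.eq_flip_iff.mpr fun e => h l.2 (e ▸ hl), fun h p hp => ?_⟩
  exact Sign.eq_flip_iff.mp (h _ hp) rfl

theorem NonCritical.of_vars_eq_empty {a : Form P N} (h : a.vars = ∅) (s : Sign) :
    a.NonCritical ε s := by
  simp [NonCritical, leaves_eq_empty h]

/-- The binary join of formulas signed `s`: disjunction for `+`, and conjunction for `-`, where
the order is reversed. -/
def join : Sign → Form P N → Form P N → Form P N
  | .plus => or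
  | .minus => and

theorem leaves_join (s t : Sign) (a b : Form P N) :
    (join t a b).leaves s = a.leaves s ∪ b.leaves s := by
  cases t <;> rfl

theorem exists_join_eq_app_left (t : Sign) (a b : Form P N) :
    ∃ f : Frame P N, join t a b = f.app a ∧ ∀ s, f.childSign s = s := by
  cases t
  · exact ⟨.orL b, rfl, fun _ => rfl⟩
  · exact ⟨.andL b, rfl, fun _ => rfl⟩

theorem exists_join_eq_app_right (t : Sign) (a b : Form P N) :
    ∃ f : Frame P N, join t a b = f.app b ∧ ∀ s, f.childSign s = s := by
  cases t
  · exact ⟨.orR a, rfl, fun _ => rfl⟩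
  · exact ⟨.andR a, rfl, fun _ => rfl⟩

end Form

theorem Frame.IsSkeleton.isSLR_or_eq_join {s : Sign} {f : Frame P N} (hf : f.IsSkeleton s)
    (a : Form P N) : f.IsSLR s ∨ ∃ b c, f.app a = Form.join s b c := by
  rcases hf with hf | hf
  · cases s <;> cases f <;>
      first | exact hf.elim | exact .inl trivial | exact .inr ⟨_, _, rfl⟩
  · exact .inl hf

theorem Frame.IsSRA.not_isSRR {s : Sign} {f : Frame P N} (hf : f.IsSRA s) : ¬ f.IsSRR s := by
  cases s <;> cases f <;> first | exact hf.elim | exact id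

namespace Branch

theorem plug_append (C D : Branch P N) (a : Form P N) : plug (C ++ D) a = C.plug (D.plug a) := by
  induction C with
  | nil => rfl
  | cons f C ih => exact congrArg f.app ih

theorem endSign_append (C D : Branch P N) (s : Sign) :
    endSign (C ++ D) s = D.endSign (C.endSign s) := by
  induction C generalizing s with
  | nil => rfl
  | cons f _ ih => exact ih _

theorem nodes_append (C D : Branch P N) (s : Sign) :
    nodes (C ++ D) s = C.nodes s ++ D.nodes (C.endSign s) := by
  induction C generalizing s with
  | nil => rfl
  | cons f C ih => exact congrArg ((s, f) :: ·) (ih _)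

theorem allSLR_nil (s : Sign) : AllSLR ([] : Branch P N) s := by simp [AllSLR, nodes]

theorem allSLR_cons {f : Frame P N} {C : Branch P N} {s : Sign} :
    AllSLR (f :: C) s ↔ f.IsSLR s ∧ C.AllSLR (f.childSign s) := by
  simp [AllSLR, nodes]

theorem allSLR_concat {f : Frame P N} {C : Branch P N} {s : Sign} :
    AllSLR (C ++ [f]) s ↔ C.AllSLR s ∧ f.IsSLR (C.endSign s) := by
  simp [AllSLR, nodes_append, nodes, or_imp, forall_and]

theorem AllSLR.allSkeleton {C : Branch P N} {s : Sign} (h : C.AllSLR s) : C.AllSkeleton s :=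
  fun n hn => .inr (h n hn)

theorem allSkeleton_cons {f : Frame P N} {C : Branch P N} {s : Sign} :
    AllSkeleton (f :: C) s ↔ f.IsSkeleton s ∧ C.AllSkeleton (f.childSign s) := by
  simp [AllSkeleton, nodes]

end Branch

/-! ### Substitution -/

namespace Form

theorem mem_leaves_subst {p : P} {c a : Form P N} {s : Sign} {l : Sign × P}
    (h : l ∈ (subst p c a).leaves s) :
    l ∈ a.leaves s ∧ l.2 ≠ p ∨ ∃ t, (t, p) ∈ a.leaves s ∧ l ∈ c.leaves t := by
  induction a generalizing s with
  | var q =>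
    by_cases hq : q = p
    · exact .inr ⟨s, by simp [leaves, hq], by simpa [subst, hq] using h⟩
    · obtain rfl : l = (s, q) := by simpa [subst, hq, leaves] using h
      exact .inl ⟨rfl, hq⟩
  | nom | bot | top => exact h.elim
  | neg _ ih => exact ih h
  | box _ ih | dia _ ih | bdia _ ih | bbox _ ih => exact ih (s := s) h
  | and _ _ iha ihb | or _ _ iha ihb | imp _ _ iha ihb =>
    rcases h with h | h
    · exact (iha h).imp (.imp_left .inl) (.imp fun _ => .imp_left .inl)
    · exact (ihb h).imp (.imp_left .inr) (.imp fun _ => .imp_left .inr)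

theorem mem_vars_subst {p q : P} {c a : Form P N} (h : q ∈ (subst p c a).vars) :
    q ∈ a.vars ∧ q ≠ p ∨ p ∈ a.vars ∧ q ∈ c.vars := by
  obtain ⟨t, ht⟩ := (mem_vars_iff_exists_mem_leaves .plus).mp h
  exact (mem_leaves_subst ht).imp
    (.imp_left fun h => (mem_vars_iff_exists_mem_leaves _).mpr ⟨t, h⟩)
    fun ⟨u, hp, hq⟩ => ⟨(mem_vars_iff_exists_mem_leaves _).mpr ⟨u, hp⟩,
      (mem_vars_iff_exists_mem_leaves _).mpr ⟨t, hq⟩⟩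

theorem leaves_subst_subset {p : P} {c : Form P N} (hc : c.vars = ∅) (a : Form P N) (s : Sign) :
    (subst p c a).leaves s ⊆ a.leaves s := by
  intro l hl
  simpa [leaves_eq_empty hc] using (mem_leaves_subst hl).imp_left And.left

theorem vars_subst_subset {p : P} {c : Form P N} (hc : c.vars = ∅) (a : Form P N) :
    (subst p c a).vars ⊆ a.vars := by
  intro q hq
  simpa [hc] using (mem_vars_subst hq).imp_left And.left

theorem NonCritical.subst {p : P} {c a : Form P N} {s : Sign} (ha : a.NonCritical ε s)
    (hc : c.NonCritical ε (ε p).flip) : (Form.subst p c a).NonCritical ε s := by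
  intro q hq
  rcases mem_leaves_subst hq with ⟨hq, -⟩ | ⟨t, ht, hq⟩
  · exact ha q hq
  · obtain rfl : t = (ε p).flip := nonCritical_iff.mp ha _ ht
    exact hc q hq

theorem IsBasic.subst {p : P} {c a : Form P N} (hc : c.IsBasic) (ha : a.IsBasic) :
    (Form.subst p c a).IsBasic := by
  induction a with
  | var q =>
    unfold Form.subst
    split
    · exact hc
    · exact ha
  | nom | bot | top | bdia | bbox => exact ha
  | neg _ ih | box _ ih | dia _ ih => exact ih ha
  | and _ _ iha ihb | or _ _ iha ihb | imp _ _ iha ihb => exact ⟨iha ha.1, ihb ha.2⟩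

end Form

/-- Substitution of `c` for `p` in the child off the branch. -/
noncomputable def Frame.subst (p : P) (c : Form P N) : Frame P N → Frame P N
  | neg => neg
  | andL b => andL (Form.subst p c b)
  | andR b => andR (Form.subst p c b)
  | orL b => orL (Form.subst p c b)
  | orR b => orR (Form.subst p c b)
  | impL b => impL (Form.subst p c b)
  | impR b => impR (Form.subst p c b)
  | box => box
  | dia => dia
  | bdia => bdia
  | bbox => bbox

namespace Frame

variable {p : P} {c : Form P N}

theorem childSign_subst (f : Frame P N) (s : Sign) :
    (f.subst p c).childSign s = f.childSign s := by
  cases f <;> rfl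

theorem IsSkeleton.subst {f : Frame P N} {s : Sign} (h : f.IsSkeleton s) :
    (f.subst p c).IsSkeleton s := by
  cases s <;> cases f <;> exact h

theorem IsPIA.subst {f : Frame P N} {s : Sign} (h : f.IsPIA s) : (f.subst p c).IsPIA s := by
  cases s <;> cases f <;> exact h

theorem IsSRR.of_subst {f : Frame P N} {s : Sign} (h : (f.subst p c).IsSRR s) : f.IsSRR s := by
  cases s <;> cases f <;> exact h

theorem exists_mem_siblings_of_subst {f : Frame P N} {s : Sign} {d : Sign × Form P N}
    (h : d ∈ (f.subst p c).siblings s) : ∃ b, (d.1, b) ∈ f.siblings s ∧ d.2 = Form.subst p c b := by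
  cases f <;> first | exact h.elim | (cases h; exact ⟨_, rfl, rfl⟩)

theorem exists_app_of_subst_eq_app {f : Frame P N} {a d : Form P N} (hc : c ≠ f.app d)
    (h : Form.subst p c a = f.app d) :
    ∃ (g : Frame P N) (b : Form P N), a = g.app b ∧ g.subst p c = f ∧ Form.subst p c b = d := by
  cases a with
  | var q =>
    unfold Form.subst at h
    split at h
    · exact absurd h hc
    · cases f <;> cases h
  | nom | bot | top => cases f <;> cases h
  | neg b => cases f <;> cases h; exact ⟨.neg, b, rfl, rfl, rfl⟩
  | box b => cases f <;> cases h; exact ⟨.box, b, rfl, rfl, rfl⟩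
  | dia b => cases f <;> cases h; exact ⟨.dia, b, rfl, rfl, rfl⟩
  | bdia b => cases f <;> cases h; exact ⟨.bdia, b, rfl, rfl, rfl⟩
  | bbox b => cases f <;> cases h; exact ⟨.bbox, b, rfl, rfl, rfl⟩
  | and a b =>
    cases f <;> cases h
    exacts [⟨.andL b, a, rfl, rfl, rfl⟩, ⟨.andR a, b, rfl, rfl, rfl⟩]
  | or a b =>
    cases f <;> cases h
    exacts [⟨.orL b, a, rfl, rfl, rfl⟩, ⟨.orR a, b, rfl, rfl, rfl⟩]
  | imp a b =>
    cases f <;> cases h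
    exacts [⟨.impL b, a, rfl, rfl, rfl⟩, ⟨.impR a, b, rfl, rfl, rfl⟩]

end Frame

namespace Branch

variable {p : P} {c : Form P N}

theorem mem_vars_plug_var (C : Branch P N) (q : P) : q ∈ (C.plug (.var q)).vars := by
  induction C with
  | nil => rfl
  | cons f C ih => cases f <;> first | exact ih | exact .inl ih | exact .inr ih

theorem endSign_map_subst (C : Branch P N) (s : Sign) :
    endSign (C.map (Frame.subst p c)) s = C.endSign s := by
  induction C generalizing s with
  | nil => rfl
  | cons f C ih => simp only [List.map_cons, endSign, Frame.childSign_subst, ih]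

theorem nodes_map_subst (C : Branch P N) (s : Sign) :
    nodes (C.map (Frame.subst p c)) s = (C.nodes s).map (Prod.map id (Frame.subst p c)) := by
  induction C generalizing s with
  | nil => rfl
  | cons f C ih => simp only [List.map_cons, nodes, Frame.childSign_subst, ih, Prod.map, id]

theorem exists_eq_map_subst {C : Branch P N} {a : Form P N} {q : P} (hc : c.vars = ∅)
    (h : C.plug (.var q) = Form.subst p c a) :
    ∃ D : Branch P N, D.plug (.var q) = a ∧ D.map (Frame.subst p c) = C := by
  have hc' : ∀ D : Branch P N, c ≠ D.plug (.var q) := by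
    rintro D rfl
    exact Set.notMem_empty q (hc ▸ D.mem_vars_plug_var q)
  induction C generalizing a with
  | nil =>
    cases a with
    | var r =>
      unfold Form.subst at h
      split at h
      · exact absurd h.symm (hc' [])
      · exact ⟨[], h, rfl⟩
    | _ => cases h
  | cons f C ih =>
    obtain ⟨g, b, rfl, rfl, hb⟩ := Frame.exists_app_of_subst_eq_app (hc' (f :: C)) h.symm
    obtain ⟨D, rfl, rfl⟩ := ih hb.symm
    exact ⟨g :: D, rfl, rfl⟩

end Branch

/-! ### Inductive signed trees -/

/-- The condition that an inductive tree imposes on a node, of sign `s`, in the PIA part of a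
critical branch to the variable `p`. -/
def Frame.IsInductivePIA (Ω : P → P → Prop) (ε : P → Sign) (p : P) (s : Sign)
    (f : Frame P N) : Prop :=
  f.IsPIA s ∧ (f.IsSRR s → ∀ c ∈ f.siblings s,
    (∀ l ∈ c.2.leaves c.1, l.1 = (ε l.2).flip) ∧ ∀ q ∈ c.2.vars, Ω q p)

namespace Form

/-- The signed trees that can be cleared of critical leaves by residuation and splitting alone:
inductive trees all of whose critical branches have an empty Skeleton part. -/
def IsPIATree (Ω : P → P → Prop) (ε : P → Sign) (s : Sign) (a : Form P N) : Prop :=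
  ∀ (C : Branch P N) (p : P), C.plug (var p) = a → C.endSign s = ε p →
    ∀ n ∈ C.nodes s, n.2.IsInductivePIA Ω ε p n.1

theorem IsPIATree.child {f : Frame P N} {a : Form P N} {s : Sign}
    (h : (f.app a).IsPIATree Ω ε s) : a.IsPIATree Ω ε (f.childSign s) :=
  fun C p hC hp n hn => h (f :: C) p (congrArg f.app hC) hp n (.tail _ hn)

theorem IsPIATree.isInductivePIA {f : Frame P N} {a : Form P N} {s : Sign} {p : P}
    (h : (f.app a).IsPIATree Ω ε s) (hp : (ε p, p) ∈ a.leaves (f.childSign s)) :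
    f.IsInductivePIA Ω ε p s := by
  obtain ⟨C, hC, hs⟩ := exists_branch_of_mem_leaves hp
  exact h (f :: C) p (congrArg f.app hC) hs _ (.head _)

theorem IsInductive.child {f : Frame P N} {a : Form P N} {s : Sign}
    (h : (f.app a).IsInductive Ω ε s) : a.IsInductive Ω ε (f.childSign s) := by
  intro C p hC hp
  obtain ⟨P₂, P₁, hn, h₂, h₁, hSRR⟩ := h (f :: C) p (congrArg f.app hC) hp
  rcases List.cons_eq_append_iff.mp hn with ⟨rfl, rfl⟩ | ⟨Q₂, rfl, hQ⟩
  · exact ⟨[], _, rfl, by simp, fun n hn => h₁ n (.tail _ hn), fun n hn => hSRR n (.tail _ hn)⟩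
  · exact ⟨Q₂, P₁, hQ, fun n hn => h₂ n (.tail _ hn), h₁, hSRR⟩

theorem IsInductive.isPIATree {a : Form P N} {s : Sign} (h : a.IsInductive Ω ε s)
    (hroot : ∀ (f : Frame P N) b, a = f.app b → ¬ f.IsSkeleton s) : a.IsPIATree Ω ε s := by
  intro C p hC hp n hn
  obtain ⟨P₂, P₁, hP, h₂, h₁, hSRR⟩ := h C p hC hp
  obtain rfl : P₂ = [] := by
    match C, P₂ with
    | _, [] => rfl
    | f :: C, m :: _ =>
      obtain ⟨rfl, -⟩ := List.cons.inj hP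
      exact absurd (h₂ _ (.head _)) (hroot f _ hC.symm)
  rw [hP] at hn
  exact ⟨h₁ n hn, hSRR n hn⟩

theorem isInductive_of_children {a : Form P N} {s : Sign}
    (h : ∀ (f : Frame P N) b, a = f.app b → f.IsSkeleton s ∧ b.IsInductive Ω ε (f.childSign s)) :
    a.IsInductive Ω ε s := by
  rintro (_ | ⟨f, C⟩) p hC hp
  · exact ⟨[], [], rfl, by simp, by simp, by simp⟩
  · obtain ⟨hf, hb⟩ := h f _ hC.symm
    obtain ⟨P₂, P₁, hn, h₂, h₁⟩ := hb C p rfl hp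
    exact ⟨(s, f) :: P₂, P₁, congrArg _ hn, List.forall_mem_cons.mpr ⟨hf, h₂⟩, h₁⟩

theorem isInductive_neg {a : Form P N} {s : Sign} :
    (neg a).IsInductive Ω ε s ↔ a.IsInductive Ω ε s.flip := by
  refine ⟨.child (f := .neg), fun h => isInductive_of_children fun f b e => ?_⟩
  cases f <;> cases e
  exact ⟨.inr (by cases s <;> trivial), h⟩

theorem isInductive_and {a b : Form P N} {s : Sign} :
    (and a b).IsInductive Ω ε s ↔ a.IsInductive Ω ε s ∧ b.IsInductive Ω ε s := by
  refine ⟨fun h => ⟨h.child (f := .andL b), h.child (f := .andR a)⟩, fun h =>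
    isInductive_of_children fun f c e => ?_⟩
  cases f <;> cases e
  exacts [⟨.inl (by cases s <;> trivial), h.1⟩, ⟨.inl (by cases s <;> trivial), h.2⟩]

theorem isInductive_or {a b : Form P N} {s : Sign} :
    (or a b).IsInductive Ω ε s ↔ a.IsInductive Ω ε s ∧ b.IsInductive Ω ε s := by
  refine ⟨fun h => ⟨h.child (f := .orL b), h.child (f := .orR a)⟩, fun h =>
    isInductive_of_children fun f c e => ?_⟩
  cases f <;> cases e
  exacts [⟨.inl (by cases s <;> trivial), h.1⟩, ⟨.inl (by cases s <;> trivial), h.2⟩]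

theorem isInductive_minus_imp {a b : Form P N} :
    (imp a b).IsInductive Ω ε .minus ↔ a.IsInductive Ω ε .plus ∧ b.IsInductive Ω ε .minus := by
  refine ⟨fun h => ⟨h.child (f := .impL b), h.child (f := .impR a)⟩, fun h =>
    isInductive_of_children fun f c e => ?_⟩
  cases f <;> cases e
  exacts [⟨.inr trivial, h.1⟩, ⟨.inr trivial, h.2⟩]

theorem isInductive_minus_box {a : Form P N} :
    (box a).IsInductive Ω ε .minus ↔ a.IsInductive Ω ε .minus := by
  refine ⟨.child (f := .box), fun h => isInductive_of_children fun f b e => ?_⟩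
  cases f <;> cases e
  exact ⟨.inr trivial, h⟩

theorem isInductive_plus_dia {a : Form P N} :
    (dia a).IsInductive Ω ε .plus ↔ a.IsInductive Ω ε .plus := by
  refine ⟨.child (f := .dia), fun h => isInductive_of_children fun f b e => ?_⟩
  cases f <;> cases e
  exact ⟨.inr trivial, h⟩

theorem IsInductive.replace_child {f : Frame P N} {a b : Form P N} {s : Sign}
    (hf : f.IsSkeleton s) (h : (f.app a).IsInductive Ω ε s)
    (hb : b.IsInductive Ω ε (f.childSign s)) : (f.app b).IsInductive Ω ε s := by
  cases s <;> cases f <;>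
    simp_all [Frame.IsSkeleton, Frame.IsSLR, Frame.IsDeltaAdjoint, Frame.app, Frame.childSign,
      Sign.flip, isInductive_neg, isInductive_and, isInductive_or, isInductive_minus_imp,
      isInductive_minus_box, isInductive_plus_dia]

theorem IsInductive.subst {a c : Form P N} {s : Sign} (h : a.IsInductive Ω ε s) (p : P)
    (hc : c.vars = ∅) : (Form.subst p c a).IsInductive Ω ε s := by
  intro C q hC hq
  obtain ⟨D, hD, rfl⟩ := Branch.exists_eq_map_subst hc hC
  rw [Branch.endSign_map_subst] at hq
  obtain ⟨P₂, P₁, hn, h₂, h₁, hSRR⟩ := h D q hD hq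
  refine ⟨_, _, by rw [Branch.nodes_map_subst, hn, List.map_append], ?_, ?_, ?_⟩
  · exact List.forall_mem_map.mpr fun n hn => (h₂ n hn).subst
  · exact List.forall_mem_map.mpr fun n hn => (h₁ n hn).subst
  · simp only [List.forall_mem_map]
    rintro n hn hs ⟨t, d⟩ hd
    obtain ⟨b, hb, rfl⟩ := Frame.exists_mem_siblings_of_subst hd
    obtain ⟨hleaves, hvars⟩ := hSRR n hn hs.of_subst _ hb
    exact ⟨fun l hl => hleaves l (leaves_subst_subset hc b t hl),
      fun r hr => hvars r (vars_subst_subset hc b hr)⟩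

theorem IsSahlqvist.isInductive {a : Form P N} {s : Sign} (h : a.IsSahlqvist ε s) :
    a.IsInductive (fun _ _ => False) ε s := by
  intro C p hC hp
  obtain ⟨P₂, P₁, hn, h₂, h₁⟩ := h C p hC hp
  exact ⟨P₂, P₁, hn, h₂, fun n hn => .inl (h₁ n hn),
    fun n hn hs => absurd hs (h₁ n hn).not_isSRR⟩

end Form

/-! ### Distribution -/

theorem distributes_iff {s : Sign} {a d : Form P N} :
    Distributes s a d ↔ ∃ (f : Frame P N) (b c : Form P N), f.IsSLR s ∧
      a = f.app (Form.join (f.childSign s) b c) ∧ d = Form.join s (f.app b) (f.app c) := by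
  constructor
  · rintro (⟨a, b⟩ | ⟨a, b, c⟩ | ⟨a, b, c⟩ | ⟨a, b⟩ | ⟨a, b, c⟩ | ⟨a, b⟩ | ⟨a, b, c⟩ |
      ⟨a, b, c⟩ | ⟨a, b⟩ | ⟨a, b, c⟩)
    exacts [⟨.dia, a, b, trivial, rfl, rfl⟩, ⟨.andL c, a, b, trivial, rfl, rfl⟩,
      ⟨.andR c, a, b, trivial, rfl, rfl⟩, ⟨.neg, a, b, trivial, rfl, rfl⟩,
      ⟨.impL c, a, b, trivial, rfl, rfl⟩, ⟨.box, a, b, trivial, rfl, rfl⟩,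
      ⟨.orL c, a, b, trivial, rfl, rfl⟩, ⟨.orR c, a, b, trivial, rfl, rfl⟩,
      ⟨.neg, a, b, trivial, rfl, rfl⟩, ⟨.impR c, a, b, trivial, rfl, rfl⟩]
  · rintro ⟨f, b, c, hf, rfl, rfl⟩
    cases s <;> cases f <;> first | exact hf.elim | constructor

namespace Distributes

variable {s : Sign} {a d : Form P N}

theorem isBasic (h : Distributes s a d) (ha : a.IsBasic) : d.IsBasic := by
  cases h <;> simp_all only [Form.IsBasic, and_self]

theorem isInductive (h : Distributes s a d) (ha : a.IsInductive Ω ε s) : d.IsInductive Ω ε s := by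
  cases h <;>
    simp_all only [Form.isInductive_neg, Form.isInductive_and, Form.isInductive_or,
      Form.isInductive_minus_imp, Form.isInductive_minus_box, Form.isInductive_plus_dia,
      Sign.flip, and_self]

theorem isBasic_plug (h : Distributes s a d) {C : Branch P N} (ha : (C.plug a).IsBasic) :
    (C.plug d).IsBasic := by
  induction C with
  | nil => exact h.isBasic ha
  | cons f C ih =>
    have hd : (Branch.plug C d).IsBasic := ih ha.of_app
    cases f <;> first | exact ha.elim | exact ⟨hd, ha.2⟩ | exact ⟨ha.1, hd⟩ | exact hd

theorem isInductive_plug {C : Branch P N} {t : Sign} (h : Distributes (C.endSign t) a d)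
    (hC : C.AllSkeleton t) (ha : (C.plug a).IsInductive Ω ε t) :
    (C.plug d).IsInductive Ω ε t := by
  induction C generalizing t with
  | nil => exact h.isInductive ha
  | cons f C ih =>
    obtain ⟨hf, hC⟩ := Branch.allSkeleton_cons.mp hC
    exact ha.replace_child hf (ih h hC ha.child)

end Distributes

/-! ### Signed inequalities -/

namespace Ineq

/-- The inequality `a ≤ c` for `s = +`, and `c ≤ a` for `s = -`: the tree of `a` is signed `s`. -/
def signed : Sign → Form P N → Form P N → Ineq P N
  | .plus, a, c => ⟨a, c⟩
  | .minus, a, c => ⟨c, a⟩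

end Ineq

theorem Splits.signed (s : Sign) (a b c : Form P N) :
    Splits (Ineq.signed s (Form.join s a b) c) (Ineq.signed s a c) (Ineq.signed s b c) := by
  cases s
  · exact .or_left a b c
  · exact .and_right c a b

theorem Stage1Rule.dist {s : Sign} {C : Branch P N} {a b : Form P N} (hC : C.AllSkeleton s)
    (h : Distributes (C.endSign s) a b) (r : Form P N) :
    Stage1Rule (Ineq.signed s (C.plug a) r) {Ineq.signed s (C.plug b) r} := by
  cases s
  · exact .dist_left C a b r hC h
  · exact .dist_right C a b r hC h

/-! ### Stage 1 -/

namespace Splits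

variable {I J K : Ineq P N}

theorem isBasic (h : Splits I J K) (hI : I.IsBasic) : J.IsBasic ∧ K.IsBasic := by
  cases h with
  | and_right => exact ⟨⟨hI.1, hI.2.1⟩, hI.1, hI.2.2⟩
  | or_left => exact ⟨⟨hI.1.1, hI.2⟩, hI.1.2, hI.2⟩

theorem isInductive (h : Splits I J K) (hI : I.IsInductive Ω ε) :
    J.IsInductive Ω ε ∧ K.IsInductive Ω ε := by
  obtain ⟨hl, hr⟩ := hI
  cases h with
  | and_right => exact (Form.isInductive_and.mp hr).imp (⟨hl, ·⟩) (⟨hl, ·⟩)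
  | or_left => exact (Form.isInductive_or.mp hl).imp (⟨·, hr⟩) (⟨·, hr⟩)

end Splits

namespace Stage1Rule

variable {I J : Ineq P N} {L : Set (Ineq P N)}

theorem isBasic (h : Stage1Rule I L) (hI : I.IsBasic) (hJ : J ∈ L) : J.IsBasic := by
  cases h with
  | dist_left C a b r _ hd => cases hJ; exact ⟨hd.isBasic_plug hI.1, hI.2⟩
  | dist_right C a b l _ hd => cases hJ; exact ⟨hI.1, hd.isBasic_plug hI.2⟩
  | elim_bot p => cases hJ; exact ⟨.subst trivial hI.1, .subst trivial hI.2⟩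
  | elim_top p => cases hJ; exact ⟨.subst trivial hI.1, .subst trivial hI.2⟩
  | split _ K M hs =>
    rcases hJ with rfl | rfl
    exacts [(hs.isBasic hI).1, (hs.isBasic hI).2]

theorem isInductive (h : Stage1Rule I L) (hI : I.IsInductive Ω ε) (hJ : J ∈ L) :
    J.IsInductive Ω ε := by
  cases h with
  | dist_left C a b r hC hd => cases hJ; exact ⟨hd.isInductive_plug hC hI.1, hI.2⟩
  | dist_right C a b l hC hd => cases hJ; exact ⟨hI.1, hd.isInductive_plug hC hI.2⟩
  | elim_bot p => cases hJ; exact ⟨hI.1.subst p rfl, hI.2.subst p rfl⟩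
  | elim_top p => cases hJ; exact ⟨hI.1.subst p rfl, hI.2.subst p rfl⟩
  | split _ K M hs =>
    rcases hJ with rfl | rfl
    exacts [(hs.isInductive hI).1, (hs.isInductive hI).2]

end Stage1Rule

namespace Form

/-- A weight for proving termination of Stage 1. Joins in the sense of `Form.join` are additive
and all other connectives are multiplicative; the additional `1` for a join pays for distributing
a node with a factor `k ≥ 2` over it, as `k * x + k * y + 1 < k * (x + y + 1)`. Variables outweigh
constants so that eliminating one makes the tree lighter. -/
def weight : Sign → Form P N → ℕ
  | _, var _ => 3
  | _, nom _ => 2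
  | _, bot => 2
  | _, top => 2
  | s, neg a => 2 * a.weight s.flip
  | .plus, and a b => a.weight .plus * b.weight .plus
  | .minus, and a b => a.weight .minus + b.weight .minus + 1
  | .plus, or a b => a.weight .plus + b.weight .plus + 1
  | .minus, or a b => a.weight .minus * b.weight .minus
  | s, imp a b => a.weight s.flip * b.weight s
  | s, box a => 2 * a.weight s
  | s, dia a => 2 * a.weight s
  | s, bdia a => 2 * a.weight s
  | s, bbox a => 2 * a.weight s

theorem weight_join (s : Sign) (a b : Form P N) :
    (join s a b).weight s = a.weight s + b.weight s + 1 := by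
  cases s <;> rfl

theorem two_le_weight (s : Sign) (a : Form P N) : 2 ≤ a.weight s := by
  induction a generalizing s with
  | var | nom | bot | top => simp [weight]
  | neg _ ih => exact (ih _).trans (Nat.le_mul_of_pos_left _ two_pos)
  | box _ ih | dia _ ih | bdia _ ih | bbox _ ih =>
    exact (ih s).trans (Nat.le_mul_of_pos_left _ two_pos)
  | and _ _ iha ihb | or _ _ iha ihb =>
    have ha := iha s
    have hb := ihb s
    cases s <;> simp only [weight] <;> nlinarith
  | imp _ _ iha ihb => exact (iha _).trans (Nat.le_mul_of_pos_right _ (two_pos.trans_le (ihb s)))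

theorem weight_pos (s : Sign) (a : Form P N) : 0 < a.weight s :=
  two_pos.trans_le (two_le_weight s a)

theorem weight_app_lt_weight_app (f : Frame P N) {a b : Form P N} {s : Sign}
    (h : a.weight (f.childSign s) < b.weight (f.childSign s)) :
    (f.app a).weight s < (f.app b).weight s := by
  cases f with
  | neg | box | dia | bdia | bbox => exact Nat.mul_lt_mul_of_pos_left h two_pos
  | impL c => exact Nat.mul_lt_mul_of_pos_right h (weight_pos s c)
  | impR c => exact Nat.mul_lt_mul_of_pos_left h (weight_pos s.flip c)
  | andL c | orL c =>
    cases s <;> first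
      | exact Nat.mul_lt_mul_of_pos_right h (weight_pos _ c)
      | exact Nat.succ_lt_succ (Nat.add_lt_add_right h _)
  | andR c | orR c =>
    cases s <;> first
      | exact Nat.mul_lt_mul_of_pos_left h (weight_pos _ c)
      | exact Nat.succ_lt_succ (Nat.add_lt_add_left h _)

theorem weight_plug_lt_weight_plug {C : Branch P N} {s : Sign} {a b : Form P N}
    (h : a.weight (C.endSign s) < b.weight (C.endSign s)) :
    (C.plug a).weight s < (C.plug b).weight s := by
  induction C generalizing s with
  | nil => exact h
  | cons f _ ih => exact weight_app_lt_weight_app f (ih h)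

theorem weight_subst_le {p : P} {c : Form P N} (hc : ∀ s, c.weight s = 2) (a : Form P N)
    (s : Sign) : (subst p c a).weight s ≤ a.weight s := by
  induction a generalizing s with
  | var q => unfold subst; split <;> simp [weight, hc]
  | nom | bot | top => exact le_rfl
  | neg _ ih => exact Nat.mul_le_mul_left 2 (ih _)
  | box _ ih | dia _ ih | bdia _ ih | bbox _ ih => exact Nat.mul_le_mul_left 2 (ih s)
  | and _ _ iha ihb | or _ _ iha ihb =>
    have ha := iha s
    have hb := ihb s
    cases s <;> simp only [subst, weight] <;> gcongr
  | imp _ _ iha ihb => exact Nat.mul_le_mul (iha _) (ihb _)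

theorem weight_subst_lt {p : P} {c a : Form P N} (hc : ∀ s, c.weight s = 2) (hp : p ∈ a.vars)
    (s : Sign) : (subst p c a).weight s < a.weight s := by
  have hle := weight_subst_le hc (p := p)
  induction a generalizing s with
  | var q =>
    obtain rfl : p = q := hp
    simp [subst, hc, weight]
  | nom | bot | top => exact hp.elim
  | neg _ ih => exact Nat.mul_lt_mul_of_pos_left (ih hp _) two_pos
  | box _ ih | dia _ ih | bdia _ ih | bbox _ ih =>
    exact Nat.mul_lt_mul_of_pos_left (ih hp s) two_pos
  | and a b iha ihb | or a b iha ihb =>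
    have ha := hle a s
    have hb := hle b s
    have ha_pos := weight_pos s (subst p c a)
    have hb_pos := weight_pos s (subst p c b)
    rcases hp with hp | hp
    · have := iha hp s
      cases s <;> simp only [subst, weight] <;> nlinarith
    · have := ihb hp s
      cases s <;> simp only [subst, weight] <;> nlinarith
  | imp a b iha ihb =>
    rcases hp with hp | hp
    · exact Nat.mul_lt_mul_of_lt_of_le (iha hp _) (hle b s) (weight_pos _ _)
    · exact Nat.mul_lt_mul_of_le_of_lt (hle a _) (ihb hp s) (weight_pos _ _)

end Form

theorem Frame.IsSLR.exists_weight_app {f : Frame P N} {s : Sign} (hf : f.IsSLR s) :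
    ∃ k ≥ 2, ∀ a, (f.app a).weight s = k * a.weight (f.childSign s) := by
  cases s <;> cases f <;> first
    | exact hf.elim
    | exact ⟨2, le_rfl, fun _ => rfl⟩
    | exact ⟨_, Form.two_le_weight _ _, fun _ => rfl⟩
    | exact ⟨_, Form.two_le_weight _ _, fun _ => Nat.mul_comm _ _⟩

theorem Distributes.weight_lt {s : Sign} {a d : Form P N} (h : Distributes s a d) :
    d.weight s < a.weight s := by
  obtain ⟨f, b, c, hf, rfl, rfl⟩ := distributes_iff.mp h
  obtain ⟨k, hk, hweight⟩ := hf.exists_weight_app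
  simp only [Form.weight_join, hweight]
  linarith

namespace Ineq

/-- The product of the weights of the trees `+lhs` and `-rhs`, as splitting is distribution of
the inequality sign over a join. -/
def weight (I : Ineq P N) : ℕ := I.lhs.weight .plus * I.rhs.weight .minus

theorem weight_subst_lt {p : P} {c : Form P N} (hc : ∀ s, c.weight s = 2) {I : Ineq P N}
    (hp : p ∈ I.vars) : (I.subst p c).weight < I.weight := by
  rcases hp with hp | hp
  · exact Nat.mul_lt_mul_of_lt_of_le (Form.weight_subst_lt hc hp _)
      (Form.weight_subst_le hc _ _) (Form.weight_pos _ _)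
  · exact Nat.mul_lt_mul_of_le_of_lt (Form.weight_subst_le hc _ _)
      (Form.weight_subst_lt hc hp _) (Form.weight_pos _ _)

end Ineq

theorem Splits.weight_add_lt {I J K : Ineq P N} (h : Splits I J K) :
    J.weight + K.weight < I.weight := by
  cases h with
  | and_right a b c =>
    have := Form.two_le_weight .plus a
    simp only [Ineq.weight, Form.weight]
    linarith
  | or_left a b c =>
    have := Form.two_le_weight .minus c
    simp only [Ineq.weight, Form.weight]
    linarith

open Classical in
theorem Stage1Rule.exists_finset_sum_weight_lt {I : Ineq P N} {L : Set (Ineq P N)}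
    (h : Stage1Rule I L) :
    ∃ F : Finset (Ineq P N), (F : Set (Ineq P N)) = L ∧ ∑ J ∈ F, J.weight < I.weight := by
  have hsingle {J : Ineq P N} (hJ : J.weight < I.weight) :
      ∃ F : Finset (Ineq P N), (F : Set (Ineq P N)) = {J} ∧ ∑ K ∈ F, K.weight < I.weight :=
    ⟨{J}, by simp, by simpa using hJ⟩
  cases h with
  | dist_left C a b r hC hd =>
    exact hsingle (Nat.mul_lt_mul_of_pos_right
      (Form.weight_plug_lt_weight_plug hd.weight_lt) (Form.weight_pos _ r))
  | dist_right C a b l hC hd =>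
    exact hsingle (Nat.mul_lt_mul_of_pos_left
      (Form.weight_plug_lt_weight_plug hd.weight_lt) (Form.weight_pos _ l))
  | elim_bot p _ hp => exact hsingle (Ineq.weight_subst_lt (fun _ => by simp [Form.weight]) hp)
  | elim_top p _ hp => exact hsingle (Ineq.weight_subst_lt (fun _ => by simp [Form.weight]) hp)
  | split _ J K hs =>
    refine ⟨{J, K}, by simp, lt_of_le_of_lt ?_ hs.weight_add_lt⟩
    by_cases hJK : J = K
    · simp [hJK]
    · rw [Finset.sum_pair hJK]

open Classical in
theorem exists_stage1_normal_form (F : Finset (Ineq P N)) :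
    ∃ X, Relation.ReflTransGen Stage1Step (F : Set (Ineq P N)) X ∧
      ∀ J ∈ X, ∀ L, ¬ Stage1Rule J L := by
  induction hn : ∑ J ∈ F, J.weight using Nat.strong_induction_on generalizing F with
  | _ n ih =>
    by_cases hF : ∀ J ∈ F, ∀ L, ¬ Stage1Rule J L
    · exact ⟨F, .refl, hF⟩
    push Not at hF
    obtain ⟨I, hI, L, hL⟩ := hF
    obtain ⟨G, rfl, hG⟩ := hL.exists_finset_sum_weight_lt
    have hlt : ∑ J ∈ F.erase I ∪ G, J.weight < n := by
      have hunion := Finset.sum_union_inter (s₁ := F.erase I) (s₂ := G) (f := Ineq.weight)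
      have herase := Finset.add_sum_erase F Ineq.weight hI
      omega
    obtain ⟨X, hX, hX'⟩ := ih _ hlt _ rfl
    exact ⟨X, .head ⟨I, hI, _, hL, by simp⟩ hX, hX'⟩

theorem exists_stage1Result (I : Ineq P N) : ∃ X, Stage1Result I X := by
  simpa [Stage1Result] using exists_stage1_normal_form {I}

namespace Stage1Result

variable {I : Ineq P N} {X : Set (Ineq P N)}

theorem finite (h : Stage1Result I X) : X.Finite := by
  obtain ⟨h, -⟩ := h
  induction h with
  | refl => exact Set.finite_singleton I
  | tail _ hs ih =>
    obtain ⟨J, -, L, hL, rfl⟩ := hs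
    obtain ⟨F, rfl, -⟩ := hL.exists_finset_sum_weight_lt
    exact ih.sdiff.union F.finite_toSet

theorem forall_mem {motive : Ineq P N → Prop}
    (hrule : ∀ {J L}, Stage1Rule J L → motive J → ∀ K ∈ L, motive K)
    (h : Stage1Result I X) (hI : motive I) : ∀ J ∈ X, motive J := by
  obtain ⟨h, -⟩ := h
  induction h with
  | refl => rintro _ rfl; exact hI
  | tail _ hs ih =>
    obtain ⟨J, hJ, L, hL, rfl⟩ := hs
    rintro K (hK | hK)
    · exact ih K hK.1
    · exact hrule hL (ih J hJ) K hK

end Stage1Result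

/-! ### Signed trees to which no rule of Stage 1 applies -/

/-- There is no join in the SLR part of the signed tree `s a` or directly below it. -/
def Form.IsDefinite (s : Sign) (a : Form P N) : Prop :=
  ∀ (C : Branch P N) (x y : Form P N), C.AllSLR s → a ≠ C.plug (join (C.endSign s) x y)

theorem Form.IsDefinite.child {f : Frame P N} {a : Form P N} {s : Sign}
    (h : (f.app a).IsDefinite s) (hf : f.IsSLR s) : a.IsDefinite (f.childSign s) :=
  fun C x y hC ha => h (f :: C) x y (Branch.allSLR_cons.mpr ⟨hf, hC⟩) (congrArg f.app ha)

theorem Form.isDefinite_of_forall_not_stage1Rule {s : Sign} {a r : Form P N}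
    (h : ∀ L, ¬ Stage1Rule (Ineq.signed s a r) L) : a.IsDefinite s := by
  rintro C x y hC rfl
  rcases List.eq_nil_or_concat' C with rfl | ⟨D, f, rfl⟩
  · exact h _ (.split _ _ _ (.signed s x y r))
  · obtain ⟨hD, hf⟩ := Branch.allSLR_concat.mp hC
    rw [Branch.plug_append, Branch.endSign_append] at h
    exact h _ (.dist hD.allSkeleton (distributes_iff.mpr ⟨f, x, y, hf, rfl, rfl⟩) r)

/-! ### Stage 2: approximation -/

open Relation (ReflTransGen)

/-- The formula that the approximation rules with nominal `i` put in place of a subformula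
of sign `s`. -/
def Form.signedNom (s : Sign) (i : N) : Form P N :=
  match s with
  | .plus => nom i
  | .minus => neg (nom i)

theorem Form.vars_signedNom (s : Sign) (i : N) : (signedNom s i : Form P N).vars = ∅ := by
  cases s <;> rfl

theorem Ineq.finite_noms (I : Ineq P N) : I.noms.Finite :=
  I.lhs.finite_noms.union I.rhs.finite_noms

theorem ASystem.exists_fresh [Infinite N] {S : Set (Ineq P N)} (hS : S.Finite) (E : Ineq P N) :
    ∃ i : N, ASystem.Fresh i ⟨S, E⟩ := by
  obtain ⟨i, hi⟩ := ((hS.biUnion fun J _ => J.finite_noms).union E.finite_noms).exists_notMem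
  simp only [Set.mem_union, Set.mem_iUnion, not_or, not_exists] at hi
  exact ⟨i, hi⟩

theorem Stage2Step.approx {S : Set (Ineq P N)} {C : Branch P N} {s : Sign} {c r : Form P N}
    {i : N} (hC : MaximalSLR C s c) (hc : c.IsBasic)
    (hi : ASystem.Fresh i ⟨S, Ineq.signed s (C.plug c) r⟩) :
    Stage2Step ⟨S, Ineq.signed s (C.plug c) r⟩
      ⟨S ∪ {Ineq.signed (C.endSign s) (.signedNom (C.endSign s) i) c},
        Ineq.signed s (C.plug (.signedNom (C.endSign s) i)) r⟩ := by
  cases s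
  · cases h : C.endSign .plus
    · exact .approx_left_pos S C c r i h hC hc hi
    · exact .approx_left_neg S C c r i h hC hc hi
  · cases h : C.endSign .minus
    · exact .approx_right_pos S C c r i h hC hc hi
    · exact .approx_right_neg S C c r i h hC hc hi

theorem Frame.IsSLR.of_app_eq_app {f g : Frame P N} {a b : Form P N} {s : Sign} (hf : f.IsSLR s)
    (h : f.app a = g.app b) : g.IsSLR s := by
  cases s <;> cases f <;> cases g <;> cases h <;> exact hf

/-- The inequalities that the approximation rules produce from definite inductive trees. -/
def Ineq.IsApproximation (Ω : P → P → Prop) (ε : P → Sign) (J : Ineq P N) : Prop :=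
  ∃ s i c, J = Ineq.signed s (Form.signedNom s i) c ∧ c.IsPIATree Ω ε s

namespace Form

/-- Wherever `a` stands at the end of an SLR branch with sign `t`, the approximation rules can
replace it by a formula without variables. -/
def Approximable (Ω : P → P → Prop) (ε : P → Sign) (t : Sign) (a : Form P N) : Prop :=
  ∀ (s : Sign) (C : Branch P N), C.AllSLR s → C.endSign s = t → ∀ (r : Form P N)
    (S : Set (Ineq P N)), S.Finite → (∀ J ∈ S, J.IsApproximation Ω ε) →
    ∃ S' a', S'.Finite ∧ (∀ J ∈ S', J.IsApproximation Ω ε) ∧ a'.vars = ∅ ∧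
      ReflTransGen Stage2Step ⟨S, Ineq.signed s (C.plug a) r⟩ ⟨S', Ineq.signed s (C.plug a') r⟩

namespace Approximable

variable {t : Sign} {a b : Form P N}

theorem of_isPIATree [Infinite N] (ha : a.IsBasic) (hpia : a.IsPIATree Ω ε t)
    (hroot : ∀ (f : Frame P N) b, a = f.app b → ¬ f.IsSLR t) : a.Approximable Ω ε t := by
  rintro s C hC rfl r S hS hS'
  obtain ⟨i, hi⟩ := ASystem.exists_fresh hS (Ineq.signed s (C.plug a) r)
  refine ⟨_, _, hS.union (Set.finite_singleton _), ?_, vars_signedNom _ i,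
    .single (.approx ⟨hC, hroot⟩ ha hi)⟩
  rintro J (hJ | rfl)
  · exact hS' J hJ
  · exact ⟨_, i, a, rfl, hpia⟩

theorem unary {f : Frame P N} (hf : f.IsSLR t) (hvars : ∀ x : Form P N, (f.app x).vars = x.vars)
    (ha : a.Approximable Ω ε (f.childSign t)) : (f.app a).Approximable Ω ε t := by
  rintro s C hC rfl r S hS hS'
  obtain ⟨S', a', hfin, happrox, ha', hsteps⟩ := ha s (C ++ [f])
    (Branch.allSLR_concat.mpr ⟨hC, hf⟩) (C.endSign_append [f] s) r S hS hS'
  simp only [Branch.plug_append, Branch.plug] at hsteps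
  exact ⟨S', f.app a', hfin, happrox, (hvars a').trans ha', hsteps⟩

theorem binary {f g : Form P N → Frame P N} (hfg : ∀ x y, (f y).app x = (g x).app y)
    (hf : ∀ y, (f y).IsSLR t) (hvars : ∀ x y, ((f y).app x).vars = x.vars ∪ y.vars)
    (ha : a.Approximable Ω ε ((f b).childSign t))
    (hb : ∀ x, b.Approximable Ω ε ((g x).childSign t)) : ((f b).app a).Approximable Ω ε t := by
  rintro s C hC rfl r S hS hS'
  obtain ⟨S₁, a', hfin₁, happrox₁, ha', hsteps₁⟩ := ha s (C ++ [f b])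
    (Branch.allSLR_concat.mpr ⟨hC, hf b⟩) (C.endSign_append [f b] s) r S hS hS'
  obtain ⟨S₂, b', hfin₂, happrox₂, hb', hsteps₂⟩ := hb a' s (C ++ [g a'])
    (Branch.allSLR_concat.mpr ⟨hC, (hf b).of_app_eq_app (hfg a' b)⟩)
    (C.endSign_append [g a'] s) r S₁ hfin₁ happrox₁
  simp only [Branch.plug_append, Branch.plug, ← hfg] at hsteps₁ hsteps₂
  exact ⟨S₂, (f b').app a', hfin₂, happrox₂, by simp [hvars, ha', hb'], hsteps₁.trans hsteps₂⟩

theorem of_children {f : Frame P N} (hf : f.IsSLR t)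
    (h : ∀ (g : Frame P N) b, f.app a = g.app b → b.Approximable Ω ε (g.childSign t)) :
    (f.app a).Approximable Ω ε t := by
  have hand (c d) (e : f.app a = .and c d) (hL : ∀ y : Form P N, (Frame.andL y).IsSLR t) :
      (and c d).Approximable Ω ε t :=
    .binary (f := .andL) (g := .andR) (fun _ _ => rfl) hL (fun _ _ => rfl)
      (h (.andL d) c e) fun _ => h (.andR c) d e
  have hor (c d) (e : f.app a = .or c d) (hL : ∀ y : Form P N, (Frame.orL y).IsSLR t) :
      (or c d).Approximable Ω ε t :=
    .binary (f := .orL) (g := .orR) (fun _ _ => rfl) hL (fun _ _ => rfl)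
      (h (.orL d) c e) fun _ => h (.orR c) d e
  have himp (c d) (e : f.app a = .imp c d) (hL : ∀ y : Form P N, (Frame.impL y).IsSLR t) :
      (imp c d).Approximable Ω ε t :=
    .binary (f := .impL) (g := .impR) (fun _ _ => rfl) hL (fun _ _ => rfl)
      (h (.impL d) c e) fun _ => h (.impR c) d e
  cases t <;> cases f <;> first
    | exact hf.elim
    | exact .unary hf (fun _ => rfl) (h _ a rfl)
    | exact hand _ _ rfl fun _ => trivial
    | exact hor _ _ rfl fun _ => trivial
    | exact himp _ _ rfl fun _ => trivial

end Approximable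

theorem IsInductive.approximable [Infinite N] {a : Form P N} {t : Sign}
    (hind : a.IsInductive Ω ε t) (hdef : a.IsDefinite t) (ha : a.IsBasic) :
    a.Approximable Ω ε t := by
  induction a using app_induction generalizing t with
  | step a ih =>
    by_cases hroot : ∃ (f : Frame P N) (b : Form P N), a = f.app b ∧ f.IsSLR t
    · obtain ⟨f, b, rfl, hf⟩ := hroot
      refine .of_children hf fun g c e => ?_
      rw [e] at hind hdef ha
      exact ih g c e hind.child (hdef.child (hf.of_app_eq_app e)) ha.of_app
    · push Not at hroot
      refine .of_isPIATree ha (hind.isPIATree fun f b e hf => ?_) hroot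
      rcases hf.isSLR_or_eq_join b with hf | ⟨x, y, hxy⟩
      · exact hroot f b e hf
      · exact hdef [] x y (Branch.allSLR_nil t) (e.trans hxy)

end Form

theorem Ineq.IsInductive.exists_approximation [Infinite N] {I : Ineq P N}
    (hind : I.IsInductive Ω ε) (hI : I.IsBasic) (hnormal : ∀ L, ¬ Stage1Rule I L) :
    ∃ (S : Set (Ineq P N)) (E : Ineq P N), S.Finite ∧ (∀ J ∈ S, J.IsApproximation Ω ε) ∧
      E.IsPure ∧ ReflTransGen Stage2Step ⟨∅, I⟩ ⟨S, E⟩ := by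
  obtain ⟨S₁, a, hfin₁, happrox₁, ha, hsteps₁⟩ :=
    hind.1.approximable (Form.isDefinite_of_forall_not_stage1Rule (r := I.rhs) hnormal) hI.1
      .plus [] (Branch.allSLR_nil _) rfl I.rhs ∅ Set.finite_empty (by simp)
  obtain ⟨S₂, b, hfin₂, happrox₂, hb, hsteps₂⟩ :=
    hind.2.approximable (Form.isDefinite_of_forall_not_stage1Rule (r := I.lhs) hnormal) hI.2
      .minus [] (Branch.allSLR_nil _) rfl a S₁ hfin₁ happrox₁
  exact ⟨S₂, ⟨a, b⟩, hfin₂, happrox₂, by simp [IsPure, vars, ha, hb], hsteps₁.trans hsteps₂⟩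

/-! ### Stage 2: residuation and splitting -/

namespace Ineq

/-- The signed leaves of an inequality, viewed as the implication `lhs → rhs` of sign `+`. -/
def leaves (I : Ineq P N) : Set (Sign × P) := I.lhs.leaves .minus ∪ I.rhs.leaves .plus

theorem leaves_signed (s : Sign) (a c : Form P N) :
    (signed s a c).leaves = a.leaves s.flip ∪ c.leaves s := by
  cases s
  · rfl
  · exact Set.union_comm _ _

theorem signed_left_injective (s : Sign) (c : Form P N) :
    Function.Injective fun a => signed s a c := by
  cases s <;> exact fun _ _ h => by injection h

theorem finite_vars (J : Ineq P N) : J.vars.Finite := J.lhs.finite_vars.union J.rhs.finite_vars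

theorem vars_signed (s : Sign) (a c : Form P N) : (signed s a c).vars = a.vars ∪ c.vars := by
  cases s
  · rfl
  · exact Set.union_comm _ _

theorem signed_flip (s : Sign) (a c : Form P N) : signed s.flip a c = signed s c a := by
  cases s <;> rfl

end Ineq

namespace Frame

/-- The formula `b` with `α ≤ f.app x ↔ b ≤ x`, for the nodes `f` of sign `+` that have such an
adjoint, dually for the sign `-`, and with reversed inequalities on the right if `f` reverses
signs. The value at the black connectives, which are never PIA nodes, is arbitrary. -/
def residual : Frame P N → Form P N → Form P N
  | neg, α => .neg α
  | andL c, α => .imp c α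
  | andR c, α => .imp c α
  | orL c, α => .and α (.neg c)
  | orR c, α => .and α (.neg c)
  | impL c, α => .imp α c
  | impR c, α => .and α c
  | box, α => .bdia α
  | dia, α => .bbox α
  | bdia, α => α
  | bbox, α => α

theorem mem_leaves_residual (f : Frame P N) (α : Form P N) {s : Sign} {l : Sign × P}
    (h : l ∈ (f.residual α).leaves (f.childSign s).flip) :
    l ∈ α.leaves s.flip ∨ ∃ c ∈ f.siblings s, l ∈ c.2.leaves c.1 := by
  cases s <;> cases f <;> simpa [residual, siblings, Form.leaves, childSign, Sign.flip, or_comm]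
    using h

theorem mem_vars_residual (f : Frame P N) (α : Form P N) (s : Sign) {q : P}
    (h : q ∈ (f.residual α).vars) : q ∈ α.vars ∨ ∃ c ∈ f.siblings s, q ∈ c.2.vars := by
  obtain ⟨t, ht⟩ := (Form.mem_vars_iff_exists_mem_leaves _).mp h
  exact (f.mem_leaves_residual α ht).imp
    (fun hα => (Form.mem_vars_iff_exists_mem_leaves _).mpr ⟨t, hα⟩)
    (.imp fun c => .imp_right fun hc => (Form.mem_vars_iff_exists_mem_leaves _).mpr ⟨t, hc⟩)

theorem nonCritical_residual (f : Frame P N) {α : Form P N} {s : Sign}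
    (hα : α.NonCritical ε s.flip)
    (hsib : ∀ c ∈ f.siblings s, ∀ l ∈ c.2.leaves c.1, l.1 = (ε l.2).flip) :
    (f.residual α).NonCritical ε (f.childSign s).flip := by
  refine Form.nonCritical_iff.mpr fun l hl => ?_
  rcases f.mem_leaves_residual α hl with hl | ⟨c, hc, hl⟩
  · exact Form.nonCritical_iff.mp hα l hl
  · exact hsib c hc l hl

theorem IsPIA.eq_join_or_residuates {f : Frame P N} {s : Sign} (hf : f.IsPIA s)
    (α b : Form P N) : (∃ x y, f.app b = Form.join s.flip x y) ∨
      (∀ c ∈ f.siblings s, f.IsSRR s) ∧ Residuates (Ineq.signed s α (f.app b))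
        (Ineq.signed (f.childSign s) (f.residual α) b) := by
  cases s <;> cases f <;> first
    | exact hf.elim id id |>.elim
    | exact .inl ⟨_, _, rfl⟩
    | exact .inr ⟨by simp [siblings, IsSRR], by constructor⟩

end Frame

/-- `a` is admissible as a minimal valuation for `p` (a maximal one if `ε p = ∂`): it may take
part in an Ackermann rule for `p` without making other variables critical. -/
def Form.IsBound (Ω : P → P → Prop) (ε : P → Sign) (p : P) (a : Form P N) : Prop :=
  a.NonCritical ε (ε p).flip ∧ ∀ q ∈ a.vars, Ω q p

namespace Ineq

/-- The inequalities in the shape required by the Ackermann rules. -/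
def IsSolved (Ω : P → P → Prop) (ε : P → Sign) (J : Ineq P N) : Prop :=
  (∀ p, (ε p, p) ∉ J.leaves) ∨ ∃ p a, J = signed (ε p) a (.var p) ∧ a.IsBound Ω ε p

/-- In every finite system, `I` can be replaced by solved inequalities. -/
def IsSolvable (Ω : P → P → Prop) (ε : P → Sign) (I : Ineq P N) : Prop :=
  ∀ (S : Set (Ineq P N)) (E : Ineq P N), S.Finite → ∃ S' : Set (Ineq P N), S'.Finite ∧
    ReflTransGen Stage2Step ⟨S, E⟩ ⟨S', E⟩ ∧ S' ⊆ S \ {I} ∪ {J | J.IsSolved Ω ε}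

theorem IsSolved.isSolvable {I : Ineq P N} (h : I.IsSolved Ω ε) : I.IsSolvable Ω ε := by
  refine fun S E hS => ⟨S, hS, .refl, fun J hJ => ?_⟩
  by_cases hJI : J = I
  · exact .inr (hJI ▸ h)
  · exact .inl ⟨hJ, hJI⟩

theorem isSolvable_of_mem {I : Ineq P N}
    (h : ∀ (S : Set (Ineq P N)) (E : Ineq P N), S.Finite → I ∈ S →
      ∃ S' : Set (Ineq P N), S'.Finite ∧ ReflTransGen Stage2Step ⟨S, E⟩ ⟨S', E⟩ ∧
        S' ⊆ S \ {I} ∪ {J | J.IsSolved Ω ε}) : I.IsSolvable Ω ε := by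
  intro S E hS
  by_cases hI : I ∈ S
  · exact h S E hS hI
  · exact ⟨S, hS, .refl, (Set.sdiff_singleton_eq_self hI).ge.trans Set.subset_union_left⟩

end Ineq

theorem Residuates.isSolvable {I J : Ineq P N} (h : Residuates I J) (hJ : J.IsSolvable Ω ε) :
    I.IsSolvable Ω ε := by
  refine Ineq.isSolvable_of_mem fun S E hS hI => ?_
  obtain ⟨S', hfin, hsteps, hS'⟩ := hJ (S \ {I} ∪ {J}) E (hS.sdiff.union (Set.finite_singleton J))
  refine ⟨S', hfin, .head (.residuation S E I J hI h) hsteps, hS'.trans ?_⟩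
  rw [Set.union_sdiff_right]
  exact Set.union_subset_union_left _ Set.sdiff_subset

theorem Splits.isSolvable {I J K : Ineq P N} (h : Splits I J K) (hJ : J.IsSolvable Ω ε)
    (hK : K.IsSolvable Ω ε) : I.IsSolvable Ω ε := by
  refine Ineq.isSolvable_of_mem fun S E hS hI => ?_
  obtain ⟨S₁, hfin₁, hsteps₁, hS₁⟩ := hJ (S \ {I} ∪ {J, K}) E
    (hS.sdiff.union (Set.toFinite {J, K}))
  obtain ⟨S₂, hfin₂, hsteps₂, hS₂⟩ := hK S₁ E hfin₁
  refine ⟨S₂, hfin₂, .head (.splitting S E I J K hI h) (hsteps₁.trans hsteps₂), ?_⟩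
  intro M hM
  rcases hS₂ hM with ⟨hM, hMK⟩ | hM
  · rcases hS₁ hM with ⟨hM | hMJ | hMK', hMJ'⟩ | hM
    exacts [.inl hM, absurd hMJ hMJ', absurd hMK' hMK, .inr hM]
  · exact .inr hM

theorem Form.IsPIATree.isSolvable {a α : Form P N} {s : Sign} (ha : a.IsPIATree Ω ε s)
    (hα : α.NonCritical ε s.flip)
    (hΩ : ∀ p, (ε p, p) ∈ a.leaves s → ∀ q ∈ α.vars, Ω q p) :
    (Ineq.signed s α a).IsSolvable Ω ε := by
  induction a using app_induction generalizing s α with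
  | step a ih =>
    by_cases hcrit : a.NonCritical ε s
    · refine Ineq.IsSolved.isSolvable (.inl fun p hp => ?_)
      rw [Ineq.leaves_signed] at hp
      exact hp.elim (hα p) (hcrit p)
    simp only [NonCritical, not_forall, not_not] at hcrit
    obtain ⟨p, hp⟩ := hcrit
    rcases eq_var_or_eq_app_of_mem_leaves hp with ⟨rfl, rfl⟩ | ⟨f, b, rfl, hb⟩
    · exact Ineq.IsSolved.isSolvable (.inr ⟨p, α, rfl, hα, hΩ p rfl⟩)
    obtain ⟨hPIA, hSRR⟩ := ha.isInductivePIA hb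
    rcases hPIA.eq_join_or_residuates α b with ⟨x, y, hxy⟩ | ⟨hsib, hres⟩
    · rw [hxy] at ha hΩ ih ⊢
      obtain ⟨g, hg, hgs⟩ := exists_join_eq_app_left s.flip x y
      obtain ⟨h, hh, hhs⟩ := exists_join_eq_app_right s.flip x y
      rw [leaves_join] at hΩ
      have hx := ih g x hg (hgs s ▸ (hg ▸ ha).child) hα fun p hp => hΩ p (.inl hp)
      have hy := ih h y hh (hhs s ▸ (hh ▸ ha).child) hα fun p hp => hΩ p (.inr hp)
      rw [← Ineq.signed_flip] at hx hy ⊢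
      exact (Splits.signed s.flip x y α).isSolvable hx hy
    · refine hres.isSolvable (ih f b rfl ha.child ?_ fun q hq r hr => ?_)
      · exact f.nonCritical_residual hα fun c hc => (hSRR (hsib c hc) c hc).1
      · rcases f.mem_vars_residual α s hr with hr | ⟨c, hc, hr⟩
        · exact hΩ q (mem_leaves_app hq) r hr
        · exact ((ha.isInductivePIA hq).2 (hsib c hc) c hc).2 r hr

theorem Ineq.IsApproximation.isSolvable {J : Ineq P N} (h : J.IsApproximation Ω ε) :
    J.IsSolvable Ω ε := by
  obtain ⟨s, i, c, rfl, hc⟩ := h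
  exact hc.isSolvable (.of_vars_eq_empty (Form.vars_signedNom s i) _)
    fun p _ q hq => by simp [Form.vars_signedNom] at hq

theorem exists_forall_isSolved {A : Set (Ineq P N)} (hA : A.Finite)
    (hsolvable : ∀ I ∈ A, I.IsSolvable Ω ε) (E : Ineq P N) :
    ∃ S : Set (Ineq P N), S.Finite ∧ (∀ J ∈ S, J.IsSolved Ω ε) ∧
      ReflTransGen Stage2Step ⟨A, E⟩ ⟨S, E⟩ := by
  suffices ∀ S : Set (Ineq P N), S.Finite → S ⊆ A ∪ {J | J.IsSolved Ω ε} →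
      ∃ S' : Set (Ineq P N), S'.Finite ∧ (∀ J ∈ S', J.IsSolved Ω ε) ∧
        ReflTransGen Stage2Step ⟨S, E⟩ ⟨S', E⟩ from this A hA Set.subset_union_left
  induction A, hA using Set.Finite.induction_on with
  | empty => exact fun S hS hsolved => ⟨S, hS, fun J hJ => (hsolved hJ).resolve_left id, .refl⟩
  | @insert I A _ _ ih =>
    intro S hS hSA
    obtain ⟨S₁, hfin₁, hsteps₁, hS₁⟩ := hsolvable I (.inl rfl) S E hS
    obtain ⟨S₂, hfin₂, hsolved, hsteps₂⟩ := ih (fun J hJ => hsolvable J (.inr hJ)) S₁ hfin₁ <| by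
      intro J hJ
      rcases hS₁ hJ with ⟨hJ, hJI⟩ | hJ
      · exact (hSA hJ).imp_left fun h => h.resolve_left hJI
      · exact .inr hJ
    exact ⟨S₂, hfin₂, hsolved, hsteps₁.trans hsteps₂⟩

/-! ### Stage 2: the Ackermann rules -/

namespace Form

/-- The join of a list of formulas signed `s`: the disjunction for `+` and the conjunction for
`-`. It is the extremal valuation that an Ackermann rule substitutes for a variable. -/
def bigJoin : Sign → List (Form P N) → Form P N
  | .plus => bigOr
  | .minus => bigAnd

theorem bigJoin_cons_cons (s : Sign) (a b : Form P N) (as : List (Form P N)) :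
    bigJoin s (a :: b :: as) = join s a (bigJoin s (b :: as)) := by
  cases s <;> rfl

theorem mem_leaves_bigJoin {s t : Sign} {as : List (Form P N)} {l : Sign × P}
    (h : l ∈ (bigJoin s as).leaves t) : ∃ a ∈ as, l ∈ a.leaves t := by
  induction as with
  | nil => cases s <;> exact h.elim
  | cons a as ih =>
    cases as with
    | nil => exact ⟨a, .head _, by cases s <;> exact h⟩
    | cons b as =>
      rw [bigJoin_cons_cons, leaves_join] at h
      rcases h with h | h
      · exact ⟨a, .head _, h⟩
      · obtain ⟨c, hc, hl⟩ := ih h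
        exact ⟨c, .tail _ hc, hl⟩

theorem mem_vars_bigJoin {s : Sign} {as : List (Form P N)} {q : P}
    (h : q ∈ (bigJoin s as).vars) : ∃ a ∈ as, q ∈ a.vars := by
  obtain ⟨t, ht⟩ := (mem_vars_iff_exists_mem_leaves .plus).mp h
  obtain ⟨a, ha, hl⟩ := mem_leaves_bigJoin ht
  exact ⟨a, ha, (mem_vars_iff_exists_mem_leaves _).mpr ⟨t, hl⟩⟩

theorem IsBound.bigJoin {p : P} {as : List (Form P N)} (h : ∀ a ∈ as, a.IsBound Ω ε p)
    (s : Sign) : (Form.bigJoin s as).IsBound Ω ε p := by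
  refine ⟨fun q hq => ?_, fun q hq => ?_⟩
  · obtain ⟨a, ha, hl⟩ := mem_leaves_bigJoin hq
    exact (h a ha).1 q hl
  · obtain ⟨a, ha, hq⟩ := mem_vars_bigJoin hq
    exact (h a ha).2 q hq

end Form

theorem Stage2Step.ackermann {p : P} {s : Sign} {as : List (Form P N)} {T : Set (Ineq P N)}
    {E : Ineq P N} (has : ∀ a ∈ as, p ∉ a.vars) (hE : p ∉ E.vars)
    (hT : ∀ J ∈ T, (s, p) ∉ J.leaves) :
    Stage2Step ⟨{J | ∃ a ∈ as, J = Ineq.signed s a (.var p)} ∪ T, E⟩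
      ⟨Ineq.subst p (.bigJoin s as) '' T, E⟩ := by
  cases s with
  | plus =>
    exact .right_ackermann p as _ T E rfl has hE fun J hJ =>
      ⟨fun h => hT J hJ (.inl (Form.mem_leaves_flip.mpr h)), fun h => hT J hJ (.inr h)⟩
  | minus =>
    exact .left_ackermann p as _ T E rfl has hE fun J hJ =>
      ⟨fun h => hT J hJ (.inl (Form.mem_leaves_flip.mpr h)), fun h => hT J hJ (.inr h)⟩

namespace Ineq

theorem mem_leaves_subst {p : P} {c : Form P N} {J : Ineq P N} {l : Sign × P}
    (h : l ∈ (J.subst p c).leaves) :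
    l ∈ J.leaves ∧ l.2 ≠ p ∨ ∃ t, (t, p) ∈ J.leaves ∧ l ∈ c.leaves t := by
  rcases h with h | h
  · exact (Form.mem_leaves_subst h).imp (.imp_left .inl) (.imp fun _ => .imp_left .inl)
  · exact (Form.mem_leaves_subst h).imp (.imp_left .inr) (.imp fun _ => .imp_left .inr)

theorem mem_vars_subst {p q : P} {c : Form P N} {J : Ineq P N} (h : q ∈ (J.subst p c).vars) :
    q ∈ J.vars ∧ q ≠ p ∨ q ∈ c.vars := by
  rcases h with h | h
  · exact (Form.mem_vars_subst h).imp (.imp_left .inl) And.right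
  · exact (Form.mem_vars_subst h).imp (.imp_left .inr) And.right

theorem subst_signed_var {p q : P} (hqp : q ≠ p) (s : Sign) (a c : Form P N) :
    (signed s a (.var q)).subst p c = signed s (Form.subst p c a) (.var q) := by
  cases s <;> simp [signed, subst, Form.subst, hqp]

theorem IsSolved.exists_eq_signed {J : Ineq P N} (h : J.IsSolved Ω ε) {p : P}
    (hp : (ε p, p) ∈ J.leaves) : ∃ a, J = signed (ε p) a (.var p) ∧ a.IsBound Ω ε p := by
  rcases h with h | ⟨q, a, rfl, ha⟩
  · exact absurd hp (h p)
  · rw [leaves_signed] at hp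
    obtain rfl : p = q := congrArg Prod.snd (hp.resolve_left (ha.1 p))
    exact ⟨a, rfl, ha⟩

theorem IsSolved.subst {J : Ineq P N} (hΩ : ∀ p q r, Ω p q → Ω q r → Ω p r)
    (hJ : J.IsSolved Ω ε) {p : P} (hp : (ε p, p) ∉ J.leaves) {c : Form P N}
    (hc : c.IsBound Ω ε p) : (J.subst p c).IsSolved Ω ε := by
  rcases hJ with hJ | ⟨q, a, rfl, ha⟩
  · refine .inl fun q hq => ?_
    rcases mem_leaves_subst hq with ⟨hq, -⟩ | ⟨t, ht, hq⟩
    · exact hJ q hq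
    · obtain rfl : t = (ε p).flip := Sign.eq_flip_iff.mpr fun h => hp (h ▸ ht)
      exact hc.1 q hq
  · have hqp : q ≠ p := by
      rintro rfl
      rw [leaves_signed] at hp
      exact hp (.inr rfl)
    refine .inr ⟨q, Form.subst p c a, subst_signed_var hqp _ _ _, ha.1.subst hc.1, fun r hr => ?_⟩
    rcases Form.mem_vars_subst hr with ⟨hr, -⟩ | ⟨hpa, hr⟩
    · exact ha.2 r hr
    · exact hΩ r p q (hc.2 r hr) (ha.2 p hpa)

end Ineq

theorem exists_stage2Step_eliminating (hirr : ∀ p, ¬ Ω p p)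
    (htrans : ∀ p q r, Ω p q → Ω q r → Ω p r) {S : Set (Ineq P N)} (hS : S.Finite)
    (hsolved : ∀ J ∈ S, J.IsSolved Ω ε) {E : Ineq P N} {p : P} (hE : p ∉ E.vars) :
    ∃ S' : Set (Ineq P N), S'.Finite ∧ (∀ J ∈ S', J.IsSolved Ω ε) ∧
      Stage2Step ⟨S, E⟩ ⟨S', E⟩ ∧ ∀ J ∈ S', ∀ q ∈ J.vars, q ≠ p ∧ ∃ K ∈ S, q ∈ K.vars := by
  have hfin : {a | Ineq.signed (ε p) a (.var p) ∈ S ∧ a.IsBound Ω ε p}.Finite :=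
    (hS.preimage (Ineq.signed_left_injective _ _).injOn).subset fun a ha => ha.1
  let as := hfin.toFinset.toList
  have mem_as {a : Form P N} :
      a ∈ as ↔ Ineq.signed (ε p) a (.var p) ∈ S ∧ a.IsBound Ω ε p := by simp [as]
  have hbound : (Form.bigJoin (ε p) as).IsBound Ω ε p := .bigJoin (fun a ha => (mem_as.mp ha).2) _
  let T := {J ∈ S | (ε p, p) ∉ J.leaves}
  have hST : S = {J | ∃ a ∈ as, J = Ineq.signed (ε p) a (.var p)} ∪ T := by
    refine subset_antisymm (fun J hJ => ?_) (Set.union_subset ?_ fun J hJ => hJ.1)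
    · by_cases hp : (ε p, p) ∈ J.leaves
      · obtain ⟨a, rfl, ha⟩ := (hsolved J hJ).exists_eq_signed hp
        exact .inl ⟨a, mem_as.mpr ⟨hJ, ha⟩, rfl⟩
      · exact .inr ⟨hJ, hp⟩
    · rintro _ ⟨a, ha, rfl⟩
      exact (mem_as.mp ha).1
  refine ⟨Ineq.subst p (.bigJoin (ε p) as) '' T, (hS.subset fun J hJ => hJ.1).image _, ?_, ?_, ?_⟩
  · rintro _ ⟨J, hJ, rfl⟩
    exact (hsolved J hJ.1).subst htrans hJ.2 hbound
  · have hstep := Stage2Step.ackermann (s := ε p) (as := as) (T := T) (E := E)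
      (fun a ha hp => hirr p ((mem_as.mp ha).2.2 p hp)) hE fun J hJ => hJ.2
    rwa [← hST] at hstep
  · rintro _ ⟨J, hJ, rfl⟩ q hq
    rcases Ineq.mem_vars_subst hq with ⟨hq, hqp⟩ | hq
    · exact ⟨hqp, J, hJ.1, hq⟩
    · obtain ⟨a, ha, hqa⟩ := Form.mem_vars_bigJoin hq
      refine ⟨fun h => hirr p (h ▸ hbound.2 q hq), _, (mem_as.mp ha).1, ?_⟩
      exact Ineq.vars_signed _ a _ ▸ .inl hqa

theorem exists_isPure_of_isSolved (hirr : ∀ p, ¬ Ω p p)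
    (htrans : ∀ p q r, Ω p q → Ω q r → Ω p r) {S : Set (Ineq P N)} (hS : S.Finite)
    (hsolved : ∀ J ∈ S, J.IsSolved Ω ε) {E : Ineq P N} (hE : E.IsPure) :
    ∃ T : ASystem P N, ReflTransGen Stage2Step ⟨S, E⟩ T ∧ T.IsPure := by
  suffices ∀ V : Set P, V.Finite → ∀ S : Set (Ineq P N), S.Finite →
      (∀ J ∈ S, J.IsSolved Ω ε) → (∀ J ∈ S, J.vars ⊆ V) →
      ∃ T : ASystem P N, ReflTransGen Stage2Step ⟨S, E⟩ T ∧ T.IsPure from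
    this (⋃ J ∈ S, J.vars) (hS.biUnion fun J _ => J.finite_vars) S hS hsolved
      fun J hJ => Set.subset_biUnion_of_mem hJ
  intro V hV
  induction V, hV using Set.Finite.induction_on with
  | empty =>
    exact fun S _ _ hvars => ⟨_, .refl, fun J hJ => Set.subset_empty_iff.mp (hvars J hJ), hE⟩
  | @insert p V _ _ ih =>
    intro S hS hsolved hvars
    obtain ⟨S', hfin, hsolved', hstep, hvars'⟩ :=
      exists_stage2Step_eliminating hirr htrans hS hsolved (E := E) (p := p)
        (by simp [show E.vars = ∅ from hE])
    obtain ⟨T, hsteps, hT⟩ := ih S' hfin hsolved' fun J hJ q hq => by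
      obtain ⟨hqp, K, hK, hqK⟩ := hvars' J hJ q hq
      exact (hvars K hK hqK).resolve_left hqp
    exact ⟨T, .head hstep hsteps, hT⟩

/-! ### Success of ALBA -/

theorem Ineq.IsInductive.succeeds [Infinite N] (hirr : ∀ p, ¬ Ω p p)
    (htrans : ∀ p q r, Ω p q → Ω q r → Ω p r) {I : Ineq P N} (hbasic : I.IsBasic)
    (hind : I.IsInductive Ω ε) : Succeeds I := by
  refine ⟨exists_stage1Result I, fun X hX => ⟨hX.finite, fun J hJ => ?_⟩⟩
  have hJbasic : J.IsBasic := hX.forall_mem (fun h hI _ => h.isBasic hI) hbasic J hJ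
  have hJind : J.IsInductive Ω ε := hX.forall_mem (fun h hI _ => h.isInductive hI) hind J hJ
  obtain ⟨A, E, hA, happrox, hE, hstepsA⟩ := hJind.exists_approximation hJbasic (hX.2 J hJ)
  obtain ⟨S, hS, hsolved, hstepsS⟩ :=
    exists_forall_isSolved hA (fun K hK => (happrox K hK).isSolvable) E
  obtain ⟨T, hstepsT, hT⟩ := exists_isPure_of_isSolved hirr htrans hS hsolved hE
  exact ⟨T, (hstepsA.trans hstepsS).trans hstepsT, hT⟩

end ALBA

theorem mainTheorem2 {P : Type*} {N : Type*} [Infinite N]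
    (I : ALBA.Ineq P N) (hI : I.IsBasic) :
    (∀ (Ω : P → P → Prop) (ε : P → ALBA.Sign),
      (∀ p, ¬ Ω p p) → (∀ p q r, Ω p q → Ω q r → Ω p r) →
      I.IsInductive Ω ε → ALBA.Succeeds I) ∧
    (∀ ε : P → ALBA.Sign, I.IsSahlqvist ε → ALBA.Succeeds I) :=
  ⟨fun _ _ hirr htrans hind => hind.succeeds hirr htrans hI,
    fun _ hsahl => ALBA.Ineq.IsInductive.succeeds (Ω := fun _ _ => False) (fun _ => id)
      (fun _ _ _ => False.elim) hI ⟨hsahl.1.isInductive, hsahl.2.isInductive⟩⟩
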